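/- Let $\alpha\in\mathbb R\setminus\{0,1,2,\dots\}$. Let $\mathcal P(\mathbb C^{2|2})$ be the algebra of complex superpolynomials in even variables $z_1,z_2$ and odd variables $z_3,z_4$, with (left) partial derivatives $\partial_i$, let $\mathcal I$ be the ideal generated by $2z_1z_2+z_3z_4,\ z_2^2,\ z_2z_3,\ z_2z_4$, and let $F_\alpha=\mathcal P(\mathbb C^{2|2})/\mathcal I$ be the polynomial Fock space; the classes of $z_1^k,\ z_1^kz_2,\ z_1^kz_3,\ z_1^kz_4$ ($k\ge 0$) form a basis. Define the Bessel operators $$\mathcal B(z_1)=(-\alpha+z_1\partial_1+z_3\partial_3+z_4\partial_4)\partial_1-2\alpha z_2\partial_3\partial_4,\qquad \mathcal B(z_2)=(-1+z_2\partial_2+z_3\partial_3+z_4\partial_4)\partial_2-2z_1\partial_3\partial_4,$$ $$\mathcal B(z_3)=(-2\alpha+2z_1\partial_1+2\alpha z_2\partial_2+2(1+\alpha)z_3\partial_3)\partial_4+z_3\partial_1\partial_2,$$ $$\mathcal B(z_4)=(2\alpha-2z_1\partial_1-2\alpha z_2\partial_2-2(1+\alpha)z_4\partial_4)\partial_3+z_4\partial_1\partial_2.$$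 The Bessel–Fischer product on $F_\alpha$ is $\langle p,q\rangle_{\mathcal B}=p(\mathcal B)\bar q(z)|_{z=0}$, where $p(\mathcal B)$ is obtained by replacing each $z_i$ by $\mathcal B(z_i)$ and $\bar q$ has the conjugate coefficients. With $(-\alpha)_k=(-\alpha)(-\alpha+1)\cdots(-\alpha+k-1)$, the fundamental symmetry $S$ of $F_\alpha$ is the linear map with $S(z_1^k)=\operatorname{sgn}((-\alpha)_k)z_1^k$, $S(z_1^kz_2)=-\operatorname{sgn}((-\alpha)_k)z_1^kz_2$, $S(z_1^kz_3)=\operatorname{sgn}((-\alpha)_{k+1})z_1^kz_4$, $S(z_1^kz_4)=-\operatorname{sgn}((-\alpha)_{k+1})z_1^kz_3$. Then $(p,q)_S=\langle p,S(q)\rangle_{\mathcal B}$ is an inner product on $F_\alpha$; the Fock space $\mathbf F$ is the Hilbert space completion of $F_\alpha$ for $(\cdot,\cdot)_S$, and $\langle\cdot,\cdot\rangle_{\mathcal B}$ extends continuously to $\mathbf F$. Let $d\rho(H_2)=z_1-\mathcal B(z_1)$, an operator on $F_\alpha$. **Proposition.** There is exactly one strongly continuous one-parameter group of bounded operators on $\mathbf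 F$ whose generator is the closure of $d\rho(H_2)$ (with domain $F_\alpha$). Write $\rho_0(A_2(a))=\exp(a\,d\rho(H_2))$, $a\in\mathbb R$, for its members. Then the operators $\rho_0(A_2(a))$ are unitary operators on the Hilbert space $\mathbf F$, with inner product $(\cdot,\cdot)_S$, for all $a\in\mathbb R$ if and only if $\alpha<0$. Moreover, if $\alpha<0$, they also preserve $\langle\cdot,\cdot\rangle_{\mathcal B}$. -/

import Mathlib

noncomputable section

namespace FockD21

open MvPolynomial

/-! ### Superpolynomials in two even variables `z₁, z₂` and two odd variables `z₃, z₄` -/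

/-- Polynomials in the two even variables; `X 0` is `z₁` and `X 1` is `z₂`. -/
abbrev EvenPoly : Type := MvPolynomial (Fin 2) ℂ

/-- The superpolynomial `c + c₃ z₃ + c₄ z₄ + c₃₄ z₃ z₄`, with `c, c₃, c₄, c₃₄ ∈ ℂ[z₁, z₂]`. -/
@[ext]
structure SuperPoly : Type where
  c : EvenPoly
  c₃ : EvenPoly
  c₄ : EvenPoly
  c₃₄ : EvenPoly

namespace SuperPoly

instance : Zero SuperPoly := ⟨⟨0, 0, 0, 0⟩⟩
instance : One SuperPoly := ⟨⟨1, 0, 0, 0⟩⟩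
instance : Add SuperPoly := ⟨fun p q => ⟨p.c + q.c, p.c₃ + q.c₃, p.c₄ + q.c₄, p.c₃₄ + q.c₃₄⟩⟩
instance : Neg SuperPoly := ⟨fun p => ⟨-p.c, -p.c₃, -p.c₄, -p.c₃₄⟩⟩
instance : SMul ℂ SuperPoly := ⟨fun a p => ⟨a • p.c, a • p.c₃, a • p.c₄, a • p.c₃₄⟩⟩
/-- The product with `z₃² = z₄² = 0` and `z₄ z₃ = - z₃ z₄`. -/
instance : Mul SuperPoly := ⟨fun p q =>
  ⟨p.c * q.c,
   p.c * q.c₃ + p.c₃ * q.c,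
   p.c * q.c₄ + p.c₄ * q.c,
   p.c * q.c₃₄ + p.c₃ * q.c₄ - p.c₄ * q.c₃ + p.c₃₄ * q.c⟩⟩

@[simp] theorem zero_c : (0 : SuperPoly).c = 0 := rfl
@[simp] theorem zero_c₃ : (0 : SuperPoly).c₃ = 0 := rfl
@[simp] theorem zero_c₄ : (0 : SuperPoly).c₄ = 0 := rfl
@[simp] theorem zero_c₃₄ : (0 : SuperPoly).c₃₄ = 0 := rfl
@[simp] theorem one_c : (1 : SuperPoly).c = 1 := rfl
@[simp] theorem one_c₃ : (1 : SuperPoly).c₃ = 0 := rfl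
@[simp] theorem one_c₄ : (1 : SuperPoly).c₄ = 0 := rfl
@[simp] theorem one_c₃₄ : (1 : SuperPoly).c₃₄ = 0 := rfl
@[simp] theorem add_c (p q : SuperPoly) : (p + q).c = p.c + q.c := rfl
@[simp] theorem add_c₃ (p q : SuperPoly) : (p + q).c₃ = p.c₃ + q.c₃ := rfl
@[simp] theorem add_c₄ (p q : SuperPoly) : (p + q).c₄ = p.c₄ + q.c₄ := rfl
@[simp] theorem add_c₃₄ (p q : SuperPoly) : (p + q).c₃₄ = p.c₃₄ + q.c₃₄ := rfl
@[simp] theorem neg_c (p : SuperPoly) : (-p).c = -p.c := rfl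
@[simp] theorem neg_c₃ (p : SuperPoly) : (-p).c₃ = -p.c₃ := rfl
@[simp] theorem neg_c₄ (p : SuperPoly) : (-p).c₄ = -p.c₄ := rfl
@[simp] theorem neg_c₃₄ (p : SuperPoly) : (-p).c₃₄ = -p.c₃₄ := rfl
@[simp] theorem smul_c (a : ℂ) (p : SuperPoly) : (a • p).c = a • p.c := rfl
@[simp] theorem smul_c₃ (a : ℂ) (p : SuperPoly) : (a • p).c₃ = a • p.c₃ := rfl
@[simp] theorem smul_c₄ (a : ℂ) (p : SuperPoly) : (a • p).c₄ = a • p.c₄ := rfl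
@[simp] theorem smul_c₃₄ (a : ℂ) (p : SuperPoly) : (a • p).c₃₄ = a • p.c₃₄ := rfl
@[simp] theorem mul_c (p q : SuperPoly) : (p * q).c = p.c * q.c := rfl
@[simp] theorem mul_c₃ (p q : SuperPoly) : (p * q).c₃ = p.c * q.c₃ + p.c₃ * q.c := rfl
@[simp] theorem mul_c₄ (p q : SuperPoly) : (p * q).c₄ = p.c * q.c₄ + p.c₄ * q.c := rfl
@[simp] theorem mul_c₃₄ (p q : SuperPoly) :
    (p * q).c₃₄ = p.c * q.c₃₄ + p.c₃ * q.c₄ - p.c₄ * q.c₃ + p.c₃₄ * q.c := rfl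

instance : Ring SuperPoly where
  add_assoc _ _ _ := by ext1 <;> simp [add_assoc]
  zero_add _ := by ext1 <;> simp
  add_zero _ := by ext1 <;> simp
  add_comm _ _ := by ext1 <;> simp [add_comm]
  neg_add_cancel _ := by ext1 <;> simp
  nsmul := nsmulRec
  zsmul := zsmulRec
  mul_assoc _ _ _ := by ext1 <;> simp <;> ring
  one_mul _ := by ext1 <;> simp
  mul_one _ := by ext1 <;> simp
  left_distrib _ _ _ := by ext1 <;> simp <;> ring
  right_distrib _ _ _ := by ext1 <;> simp <;> ring
  zero_mul _ := by ext1 <;> simp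
  mul_zero _ := by ext1 <;> simp

@[simp] theorem sub_c (p q : SuperPoly) : (p - q).c = p.c - q.c := by simp [sub_eq_add_neg]
@[simp] theorem sub_c₃ (p q : SuperPoly) : (p - q).c₃ = p.c₃ - q.c₃ := by simp [sub_eq_add_neg]
@[simp] theorem sub_c₄ (p q : SuperPoly) : (p - q).c₄ = p.c₄ - q.c₄ := by simp [sub_eq_add_neg]
@[simp] theorem sub_c₃₄ (p q : SuperPoly) : (p - q).c₃₄ = p.c₃₄ - q.c₃₄ := by
  simp [sub_eq_add_neg]

instance : Module ℂ SuperPoly where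
  one_smul _ := by ext1 <;> simp
  mul_smul _ _ _ := by ext1 <;> simp [mul_smul]
  smul_zero _ := by ext1 <;> simp
  smul_add _ _ _ := by ext1 <;> simp
  add_smul _ _ _ := by ext1 <;> simp [add_smul]
  zero_smul _ := by ext1 <;> simp

instance : Algebra ℂ SuperPoly := Algebra.ofModule
  (fun _ _ _ => by ext1 <;> simp [smul_sub])
  (fun _ _ _ => by ext1 <;> simp [smul_sub])

end SuperPoly

/-- The even variables `z₁, z₂` and the odd variables `z₃, z₄`. -/
def z₁ : SuperPoly := ⟨X 0, 0, 0, 0⟩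
def z₂ : SuperPoly := ⟨X 1, 0, 0, 0⟩
def z₃ : SuperPoly := ⟨0, 1, 0, 0⟩
def z₄ : SuperPoly := ⟨0, 0, 1, 0⟩

/-- Multiplication from the left by a superpolynomial. -/
def mulOp (p : SuperPoly) : Module.End ℂ SuperPoly := LinearMap.mulLeft ℂ p

/-- The even partial derivatives `∂/∂z₁` (`i = 0`) and `∂/∂z₂` (`i = 1`). -/
def evenDeriv (i : Fin 2) : Module.End ℂ SuperPoly where
  toFun p := ⟨pderiv i p.c, pderiv i p.c₃, pderiv i p.c₄, pderiv i p.c₃₄⟩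
  map_add' _ _ := by ext1 <;> simp
  map_smul' _ _ := by ext1 <;> simp

def d₁ : Module.End ℂ SuperPoly := evenDeriv 0
def d₂ : Module.End ℂ SuperPoly := evenDeriv 1

/-- The odd (left) derivative `∂/∂z₃`. -/
def d₃ : Module.End ℂ SuperPoly where
  toFun p := ⟨p.c₃, 0, p.c₃₄, 0⟩
  map_add' _ _ := by ext1 <;> simp
  map_smul' _ _ := by ext1 <;> simp

/-- The odd (left) derivative `∂/∂z₄`; so `∂/∂z₄ (z₃ z₄) = - z₃`. -/
def d₄ : Module.End ℂ SuperPoly where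
  toFun p := ⟨p.c₄, -p.c₃₄, 0, 0⟩
  map_add' _ _ := by ext1 <;> simp [add_comm]
  map_smul' _ _ := by ext1 <;> simp

/-! ### Bessel operators (for the parameter `λ = α`) -/

section Bessel
variable (α : ℝ)

def bessel₁ : Module.End ℂ SuperPoly :=
  (-(α : ℂ) • 1 + mulOp z₁ * d₁ + mulOp z₃ * d₃ + mulOp z₄ * d₄) * d₁
    - (2 * (α : ℂ)) • (mulOp z₂ * d₃ * d₄)

/-- The scalar term of `𝓑(z₂)` is `- λ / α = - 1`. -/
def bessel₂ : Module.End ℂ SuperPoly :=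
  (-1 + mulOp z₂ * d₂ + mulOp z₃ * d₃ + mulOp z₄ * d₄) * d₂
    - (2 : ℂ) • (mulOp z₁ * d₃ * d₄)

def bessel₃ : Module.End ℂ SuperPoly :=
  (-(2 * (α : ℂ)) • 1 + (2 : ℂ) • (mulOp z₁ * d₁) + (2 * (α : ℂ)) • (mulOp z₂ * d₂)
      + (2 * (1 + (α : ℂ))) • (mulOp z₃ * d₃)) * d₄
    + mulOp z₃ * d₁ * d₂

def bessel₄ : Module.End ℂ SuperPoly :=
  ((2 * (α : ℂ)) • 1 - (2 : ℂ) • (mulOp z₁ * d₁) - (2 * (α : ℂ)) • (mulOp z₂ * d₂)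
      - (2 * (1 + (α : ℂ))) • (mulOp z₄ * d₄)) * d₃
    + mulOp z₄ * d₁ * d₂

/-- `c(𝓑(z₁), 𝓑(z₂))` for `c ∈ ℂ[z₁, z₂]`. -/
def evenSubst : EvenPoly →ₗ[ℂ] Module.End ℂ SuperPoly :=
  (basisMonomials (Fin 2) ℂ).constr ℂ fun m => bessel₁ α ^ m 0 * bessel₂ ^ m 1

/-- `p(𝓑)`: the operator obtained from `p` by replacing each `zᵢ` by its Bessel operator. -/
def besselSubst (p : SuperPoly) : Module.End ℂ SuperPoly :=
  evenSubst α p.c + evenSubst α p.c₃ * bessel₃ α + evenSubst α p.c₄ * bessel₄ α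
    + evenSubst α p.c₃₄ * bessel₃ α * bessel₄ α

/-- Conjugation of the coefficients. -/
def conjPoly (q : SuperPoly) : SuperPoly :=
  ⟨map (starRingEnd ℂ) q.c, map (starRingEnd ℂ) q.c₃, map (starRingEnd ℂ) q.c₄,
    map (starRingEnd ℂ) q.c₃₄⟩

/-- Evaluation at `z = 0`. -/
def evalZero (p : SuperPoly) : ℂ := constantCoeff p.c

/-- The Bessel-Fischer product on superpolynomials: `p(𝓑) q̄ |_{z = 0}`. -/
def bfSuper (p q : SuperPoly) : ℂ := evalZero (besselSubst α p (conjPoly q))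

/-- The operator `dρ(H₂) = z₁ - 𝓑(z₁)` on superpolynomials. -/
def dρH₂Super : Module.End ℂ SuperPoly := mulOp z₁ - bessel₁ α

end Bessel

/-! ### The polynomial Fock space -/

/-- The ideal `𝓘 = P · V`, with `V` spanned by `2z₁z₂ + z₃z₄`, `z₂²`, `z₂z₃`, `z₂z₄`. -/
def fockIdeal : Submodule ℂ SuperPoly :=
  (Ideal.span ({(2 : ℂ) • (z₁ * z₂) + z₃ * z₄, z₂ ^ 2, z₂ * z₃, z₂ * z₄} : Set SuperPoly)).restrictScalars ℂ

/-- Coefficients of the normal form `f₁(z₁) + f₂(z₁) z₂ + f₃(z₁) z₃ + f₄(z₁) z₄`. -/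
abbrev NF : Type := Polynomial ℂ × Polynomial ℂ × Polynomial ℂ × Polynomial ℂ

/-- Restriction to `z₂ = 0`. -/
def ev : EvenPoly →ₐ[ℂ] Polynomial ℂ := aeval ![Polynomial.X, 0]

theorem ev_X0 : ev (X 0) = Polynomial.X := by simp [ev]
theorem ev_X1 : ev (X 1) = 0 := by simp [ev]

theorem ev_C (a : ℂ) : ev (C a) = Polynomial.C a := by simp [ev]

theorem poly_C_two : (Polynomial.C 2 : Polynomial ℂ) = 2 := map_ofNat _ 2

theorem ev_pderiv_zero (c : EvenPoly) : ev (pderiv 0 c) = Polynomial.derivative (ev c) := by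
  induction c using MvPolynomial.induction_on with
  | C a => simp [ev]
  | add p q hp hq => simp [hp, hq]
  | mul_X p i hp =>
    fin_cases i
    · simp [hp, ev_X0, pderiv_X]; ring
    · simp [hp, ev_X1, pderiv_X]

theorem pderiv_swap (c : EvenPoly) : pderiv 1 (pderiv 0 c) = pderiv 0 (pderiv 1 c) := by
  induction c using MvPolynomial.induction_on with
  | C a => simp
  | add p q hp hq => simp [hp, hq]
  | mul_X p i hp =>
    fin_cases i <;> simp [hp, pderiv_X] <;> ring

/-- The normal form of a superpolynomial modulo the ideal. -/
def nf : SuperPoly →ₗ[ℂ] NF where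
  toFun p := (ev p.c, ev (pderiv 1 p.c) - 2 * Polynomial.X * ev p.c₃₄, ev p.c₃, ev p.c₄)
  map_add' p q := by ext1 <;> simp; ring
  map_smul' a p := by ext1 <;> simp [smul_sub]

/-- Polynomials in one variable as polynomials in `z₁`. -/
def toEven : Polynomial ℂ →ₐ[ℂ] EvenPoly := Polynomial.aeval (X 0)

theorem ev_toEven (f : Polynomial ℂ) : ev (toEven f) = f := by
  have : (ev.comp toEven) = AlgHom.id ℂ _ := by
    ext; simp [toEven, ev_X0]
  exact DFunLike.congr_fun this f

theorem pderiv_toEven (f : Polynomial ℂ) : pderiv 1 (toEven f) = 0 := by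
  induction f using Polynomial.induction_on' with
  | add p q hp hq => simp [hp, hq]
  | monomial n a =>
    simp [toEven, Polynomial.aeval_monomial, pderiv_X, algebraMap_eq]

/-- The superpolynomial with a given normal form. -/
def ofNF (f : NF) : SuperPoly :=
  ⟨toEven f.1 + toEven f.2.1 * X 1, toEven f.2.2.1, toEven f.2.2.2, 0⟩

theorem nf_ofNF (f : NF) : nf (ofNF f) = f := by
  obtain ⟨f1, f2, f3, f4⟩ := f
  simp [nf, ofNF, ev_toEven, ev_X1, pderiv_toEven, pderiv_X]

/-- Every polynomial is `f(z₁) + z₂ g(z₁) + z₂² h`. -/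
theorem even_decomp (c : EvenPoly) :
    ∃ h, c = toEven (ev c) + toEven (ev (pderiv 1 c)) * X 1 + h * X 1 ^ 2 := by
  induction c using MvPolynomial.induction_on with
  | C a => exact ⟨0, by simp [ev, toEven, algebraMap_eq]⟩
  | add p q hp hq =>
    obtain ⟨h, hh⟩ := hp
    obtain ⟨k, hk⟩ := hq
    refine ⟨h + k, ?_⟩
    conv_lhs => rw [hh, hk]
    simp only [map_add]; ring
  | mul_X p i hp =>
    obtain ⟨h, hh⟩ := hp
    fin_cases i
    · refine ⟨h * X 0, ?_⟩
      conv_lhs => rw [hh]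
      simp [ev_X0, pderiv_X, toEven]; ring
    · refine ⟨toEven (ev (pderiv 1 p)) + h * X 1, ?_⟩
      conv_lhs => rw [hh]
      simp [ev_X1, pderiv_X]; ring

theorem nf_mul_left (a p : SuperPoly) (hp : nf p = 0) : nf (a * p) = 0 := by
  simp only [nf, LinearMap.coe_mk, AddHom.coe_mk, Prod.mk_eq_zero] at hp ⊢
  obtain ⟨h1, h2, h3, h4⟩ := hp
  have h2' := sub_eq_zero.1 h2
  refine ⟨by simp [h1], ?_, by simp [h1, h3], by simp [h1, h4]⟩
  simp [h1, h2', h3, h4]; ring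

theorem fockIdeal_le_ker : fockIdeal ≤ LinearMap.ker nf := by
  intro p hp
  have hp' : p ∈ Ideal.span
      ({(2 : ℂ) • (z₁ * z₂) + z₃ * z₄, z₂ ^ 2, z₂ * z₃, z₂ * z₄} : Set SuperPoly) := hp
  rw [LinearMap.mem_ker]
  induction hp' using Submodule.span_induction with
  | mem x hx =>
    simp only [Set.mem_insert_iff, Set.mem_singleton_iff] at hx
    rcases hx with rfl | rfl | rfl | rfl <;>
      simp [nf, pow_two, z₁, z₂, z₃, z₄, ev_X0, ev_X1, pderiv_X, two_smul, two_mul]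
  | zero => simp
  | add x y hx hy h1 h2 => rw [map_add, h1 hx, h2 hy, add_zero]
  | smul a x hx h => exact nf_mul_left a x (h hx)

theorem ker_le_fockIdeal : LinearMap.ker nf ≤ fockIdeal := by
  intro p hp
  rw [LinearMap.mem_ker] at hp
  simp only [nf, LinearMap.coe_mk, AddHom.coe_mk, Prod.mk_eq_zero] at hp
  obtain ⟨h1, h2, h3, h4⟩ := hp
  have h2' := sub_eq_zero.1 h2
  obtain ⟨h, hc⟩ := even_decomp p.c
  obtain ⟨k, hk⟩ := even_decomp p.c₃
  obtain ⟨l, hl⟩ := even_decomp p.c₄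
  obtain ⟨m, hm⟩ := even_decomp p.c₃₄
  rw [h1, h2'] at hc
  rw [h3] at hk
  rw [h4] at hl
  set u := toEven (ev p.c₃₄) with hu
  set k' := toEven (ev (pderiv 1 p.c₃))
  set l' := toEven (ev (pderiv 1 p.c₄))
  set m' := toEven (ev (pderiv 1 p.c₃₄))
  have key : p = (⟨u, 0, 0, 0⟩ : SuperPoly) * ((2 : ℂ) • (z₁ * z₂) + z₃ * z₄)
      + (⟨h, 0, 0, 0⟩ : SuperPoly) * z₂ ^ 2
      + (⟨k' + k * X 1, 0, 0, 0⟩ : SuperPoly) * (z₂ * z₃)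
      + (⟨l' + l * X 1, m' + m * X 1, 0, 0⟩ : SuperPoly) * (z₂ * z₄) := by
    ext1
    · simp [pow_two, z₁, z₂, z₃, z₄]
      rw [hc]; simp only [map_zero, map_mul, map_ofNat, ← hu, smul_eq_C_mul]; simp [toEven]; ring
    · simp [pow_two, z₁, z₂, z₃, z₄]
      rw [hk]; simp; ring
    · simp [pow_two, z₁, z₂, z₃, z₄]
      rw [hl]; simp; ring
    · simp [pow_two, z₁, z₂, z₃, z₄]
      rw [hm]; ring
  rw [key]
  show _ ∈ Ideal.span
      ({(2 : ℂ) • (z₁ * z₂) + z₃ * z₄, z₂ ^ 2, z₂ * z₃, z₂ * z₄} : Set SuperPoly)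
  refine Ideal.add_mem _ (Ideal.add_mem _ (Ideal.add_mem _ ?_ ?_) ?_) ?_ <;>
    exact Ideal.mul_mem_left _ _ (Ideal.subset_span (by simp))

theorem fockIdeal_eq_ker : fockIdeal = LinearMap.ker nf :=
  le_antisymm fockIdeal_le_ker ker_le_fockIdeal

/-! ### Bessel operators and the Bessel-Fischer product in normal form -/

section NormalForm
variable (α : ℝ)

theorem ev_z₂_deriv (c : EvenPoly) : ev (pderiv 1 (pderiv 0 c))
    = Polynomial.derivative (ev (pderiv 1 c)) := by
  rw [pderiv_swap, ev_pderiv_zero]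

/-- `(a + z d/dz) f`. -/
def shiftEuler (a : ℂ) (f : Polynomial ℂ) : Polynomial ℂ :=
  a • f + Polynomial.X * Polynomial.derivative f

theorem nf_bessel₁ (p : SuperPoly) : nf (bessel₁ α p) =
    (shiftEuler (-α) (Polynomial.derivative (nf p).1),
     shiftEuler (-α) (Polynomial.derivative (nf p).2.1),
     shiftEuler (1 - α) (Polynomial.derivative (nf p).2.2.1),
     shiftEuler (1 - α) (Polynomial.derivative (nf p).2.2.2)) := by
  simp only [bessel₁]
  generalize (α : ℂ) = a
  simp [nf, shiftEuler, mulOp, d₁, d₃, d₄, evenDeriv, z₁, z₂, z₃, z₄, ev_X0, ev_X1,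
    ev_pderiv_zero, ev_z₂_deriv, pderiv_X, Polynomial.smul_eq_C_mul, smul_eq_C_mul, poly_C_two]
  refine ⟨?_, ?_, ?_⟩ <;> ring

theorem nf_bessel₂ (p : SuperPoly) : nf (bessel₂ p) = (-(nf p).2.1, 0, 0, 0) := by
  simp [nf, bessel₂, mulOp, d₂, d₃, d₄, evenDeriv, z₁, z₂, z₃, z₄, ev_X0, ev_X1,
    pderiv_X, smul_eq_C_mul, poly_C_two]
  constructor <;> ring

theorem nf_bessel₃ (p : SuperPoly) : nf (bessel₃ α p) =
    ((2 : ℂ) • shiftEuler (-α) (nf p).2.2.2, 0, Polynomial.derivative (nf p).2.1, 0) := by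
  simp only [bessel₃]
  generalize (α : ℂ) = a
  simp [nf, shiftEuler, mulOp, d₁, d₂, d₃, d₄, evenDeriv, z₁, z₂, z₃, ev_X0, ev_X1,
    ev_pderiv_zero, ev_z₂_deriv, pderiv_X, Polynomial.smul_eq_C_mul, smul_eq_C_mul, poly_C_two]
  refine ⟨?_, ?_, ?_⟩ <;> ring

theorem nf_bessel₄ (p : SuperPoly) : nf (bessel₄ α p) =
    (-(2 : ℂ) • shiftEuler (-α) (nf p).2.2.1, 0, 0, Polynomial.derivative (nf p).2.1) := by
  simp only [bessel₄]
  generalize (α : ℂ) = a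
  simp [nf, shiftEuler, mulOp, d₁, d₂, d₃, d₄, evenDeriv, z₁, z₂, z₄, ev_X0, ev_X1,
    ev_pderiv_zero, ev_z₂_deriv, pderiv_X, Polynomial.smul_eq_C_mul, smul_eq_C_mul, poly_C_two]
  refine ⟨?_, ?_, ?_⟩ <;> ring

/-- The number `k! (-α)_k`, with the Pochhammer symbol `(a)_k = a (a + 1) ⋯ (a + k - 1)`. -/
def wt (k : ℕ) : ℝ := k.factorial * (ascPochhammer ℝ k).eval (-α)

theorem wt_zero : wt α 0 = 1 := by simp [wt]

theorem wt_succ (k : ℕ) : wt α (k + 1) = (k + 1) * (k - α) * wt α k := by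
  simp [wt, Nat.factorial_succ, ascPochhammer_succ_eval]; ring

/-- The bilinear pairing `∑ w_k f_k g_k`. -/
def pair (w : ℕ → ℝ) (f g : Polynomial ℂ) : ℂ := f.sum fun k a => a * w k * g.coeff k

theorem pair_eq (w : ℕ → ℝ) (f g : Polynomial ℂ) (N : ℕ) (hN : f.natDegree < N) :
    pair w f g = ∑ k ∈ Finset.range N, f.coeff k * w k * g.coeff k :=
  Polynomial.sum_over_range' f (fun _ => by simp) N hN

theorem pair_add_left (w : ℕ → ℝ) (f f' g : Polynomial ℂ) :
    pair w (f + f') g = pair w f g + pair w f' g :=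
  Polynomial.sum_add_index f f' _ (fun _ => by simp) (fun _ _ _ => by ring)

theorem pair_smul_left (w : ℕ → ℝ) (a : ℂ) (f g : Polynomial ℂ) :
    pair w (a • f) g = a * pair w f g := by
  have h1 := pair_eq w (a • f) g (f.natDegree + 1)
    (Nat.lt_succ_of_le (Polynomial.natDegree_smul_le a f))
  rw [h1, pair_eq w f g _ (Nat.lt_succ_self _), Finset.mul_sum]
  exact Finset.sum_congr rfl fun k _ => by simp; ring

theorem pair_neg_left (w : ℕ → ℝ) (f g : Polynomial ℂ) : pair w (-f) g = -pair w f g := by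
  have := pair_smul_left w (-1) f g
  simpa using this

theorem pair_monomial (w : ℕ → ℝ) (n : ℕ) (a : ℂ) (g : Polynomial ℂ) :
    pair w (Polynomial.monomial n a) g = a * w n * g.coeff n :=
  Polynomial.sum_monomial_index a _ (by simp)

theorem coeff_shiftEuler_derivative (a : ℂ) (f : Polynomial ℂ) (k : ℕ) :
    (shiftEuler a (Polynomial.derivative f)).coeff k = (a + k) * (k + 1) * f.coeff (k + 1) := by
  cases k with
  | zero => simp [shiftEuler, Polynomial.coeff_derivative]
  | succ k => simp [shiftEuler, Polynomial.coeff_derivative]; ring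

theorem coeff_shiftEuler (a : ℂ) (f : Polynomial ℂ) (k : ℕ) :
    (shiftEuler a f).coeff k = (a + k) * f.coeff k := by
  cases k with
  | zero => simp [shiftEuler]
  | succ k => simp [shiftEuler, Polynomial.coeff_derivative]; ring

theorem evalZero_eq (p : SuperPoly) : evalZero p = (nf p).1.coeff 0 := by
  obtain ⟨c, c3, c4, c34⟩ := p
  simp only [evalZero, nf, LinearMap.coe_mk, AddHom.coe_mk]
  induction c using MvPolynomial.induction_on with
  | C a => simp [ev]
  | add p q hp hq => simp [hp, hq]
  | mul_X p i hp => fin_cases i <;> simp [ev_X0, ev_X1]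

theorem evalZero_bessel₁_pow (n : ℕ) (p : SuperPoly) :
    evalZero ((bessel₁ α ^ n) p) = wt α n * (nf p).1.coeff n := by
  induction n generalizing p with
  | zero => simp [evalZero_eq, wt_zero]
  | succ n ih =>
    rw [pow_succ, Module.End.mul_apply, ih, nf_bessel₁, coeff_shiftEuler_derivative, wt_succ]
    push_cast; ring

theorem evalZero_evenSubst (c : EvenPoly) (p : SuperPoly) :
    evalZero (evenSubst α c p) =
      pair (wt α) (ev c) (nf p).1 - pair (wt α) (ev (pderiv 1 c)) (nf p).2.1 := by
  induction c using MvPolynomial.induction_on' with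
  | monomial m a =>
    have hs : evenSubst α (monomial m a) = a • (bessel₁ α ^ m 0 * bessel₂ ^ m 1) := by
      have h1 : (monomial m a : EvenPoly) = a • basisMonomials (Fin 2) ℂ m := by
        simp [smul_monomial]
      rw [h1, map_smul, evenSubst, Module.Basis.constr_basis]
    have he : ∀ n : ℕ, m 1 = n → ev (monomial m a) = Polynomial.monomial (m 0) a * 0 ^ n := by
      intro n hn
      simp [ev, aeval_monomial, Finsupp.prod_fintype, hn, ← Polynomial.C_mul_X_pow_eq_monomial,
        mul_assoc]
    have hd : ∀ n : ℕ, m 1 = n → ev (pderiv 1 (monomial m a))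
        = n * Polynomial.monomial (m 0) a * 0 ^ (n - 1) := by
      intro n hn
      simp [ev, pderiv_monomial, aeval_monomial, Finsupp.prod_fintype, hn,
        ← Polynomial.C_mul_X_pow_eq_monomial]
      ring
    have hz : evalZero (evenSubst α (monomial m a) p)
        = a * (wt α (m 0) * (nf ((bessel₂ ^ m 1) p)).1.coeff (m 0)) := by
      rw [hs, ← evalZero_bessel₁_pow]
      simp [evalZero]
    rw [hz, he _ rfl, hd _ rfl]
    rcases hm : m 1 with _ | _ | n
    · simp [pair, mul_assoc]
    · simp [pair, nf_bessel₂, mul_assoc]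
    · have : nf ((bessel₂ ^ (n + 2)) p) = (0, 0, 0, 0) := by
        rw [add_comm, pow_add, pow_two, Module.End.mul_apply, Module.End.mul_apply, nf_bessel₂,
          nf_bessel₂]
        simp
      rw [this]
      simp [pair]
  | add c d hc hd =>
    have : evalZero ((evenSubst α c + evenSubst α d) p)
        = evalZero (evenSubst α c p) + evalZero (evenSubst α d p) := by simp [evalZero]
    rw [map_add, this, hc, hd, map_add, map_add, map_add, pair_add_left, pair_add_left]
    ring

/-- The numbers `2 k! (-α)_{k+1}`. -/
def wtOdd (k : ℕ) : ℝ := 2 * (k.factorial * (ascPochhammer ℝ (k + 1)).eval (-α))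

theorem wtOdd_eq (k : ℕ) : wtOdd α k = 2 * (k - α) * wt α k := by
  simp [wtOdd, wt, ascPochhammer_succ_eval]; ring

theorem pair_shift (w w' : ℕ → ℝ) (f g g' : Polynomial ℂ)
    (h : ∀ k, (w k : ℂ) * g.coeff k = w' k * g'.coeff k) : pair w f g = pair w' f g' := by
  unfold pair
  congr 1
  funext k a
  rw [mul_assoc, h, mul_assoc]

theorem pair_zero_right (w : ℕ → ℝ) (f : Polynomial ℂ) : pair w f 0 = 0 := by
  simp [pair, Polynomial.sum]

theorem pair_X_mul (f g : Polynomial ℂ) :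
    pair (wt α) (Polynomial.X * f) g = pair (fun k => wt α (k + 1)) f (Polynomial.divX g) := by
  induction f using Polynomial.induction_on' with
  | add p q hp hq => rw [mul_add, pair_add_left, pair_add_left, hp, hq]
  | monomial n a =>
    rw [mul_comm, Polynomial.monomial_mul_X, pair_monomial, pair_monomial, Polynomial.coeff_divX]

/-- The value of the Bessel-Fischer product in terms of normal forms. -/
def bfNF (f g : NF) : ℂ :=
  pair (wt α) f.1 g.1 - pair (wt α) f.2.1 g.2.1
    + pair (wtOdd α) f.2.2.1 g.2.2.2 - pair (wtOdd α) f.2.2.2 g.2.2.1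

theorem evalZero_besselSubst (p q : SuperPoly) :
    evalZero (besselSubst α p q) = bfNF α (nf p) (nf q) := by
  have h : evalZero (besselSubst α p q) = evalZero (evenSubst α p.c q)
      + evalZero (evenSubst α p.c₃ (bessel₃ α q)) + evalZero (evenSubst α p.c₄ (bessel₄ α q))
      + evalZero (evenSubst α p.c₃₄ (bessel₃ α (bessel₄ α q))) := by
    simp [besselSubst, evalZero]
  rw [h]
  simp only [evalZero_evenSubst, nf_bessel₃, nf_bessel₄, pair_zero_right, sub_zero]
  have e3 : pair (wt α) (ev p.c₃) ((2 : ℂ) • shiftEuler (-α) (nf q).2.2.2)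
      = pair (wtOdd α) (ev p.c₃) (nf q).2.2.2 := by
    apply pair_shift
    intro k
    rw [Polynomial.coeff_smul, coeff_shiftEuler, wtOdd_eq]
    push_cast [smul_eq_mul]; ring
  have e4 : pair (wt α) (ev p.c₄) (-(2 : ℂ) • shiftEuler (-α) (nf q).2.2.1)
      = -pair (wtOdd α) (ev p.c₄) (nf q).2.2.1 := by
    have : pair (wt α) (ev p.c₄) (-(2 : ℂ) • shiftEuler (-α) (nf q).2.2.1)
        = pair (wtOdd α) (ev p.c₄) (-(nf q).2.2.1) := by
      apply pair_shift
      intro k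
      rw [Polynomial.coeff_smul, coeff_shiftEuler, wtOdd_eq, Polynomial.coeff_neg]
      push_cast [smul_eq_mul]; ring
    rw [this]
    simp [pair, Polynomial.sum]
  have e34 : pair (wt α) (ev p.c₃₄)
        ((2 : ℂ) • shiftEuler (-α) (Polynomial.derivative (nf q).2.1))
      = pair (wt α) ((2 : ℂ) • (Polynomial.X * ev p.c₃₄)) (nf q).2.1 := by
    rw [pair_smul_left, pair_X_mul, ← pair_smul_left]
    have : pair (wt α) (ev p.c₃₄) ((2 : ℂ) • shiftEuler (-α) (Polynomial.derivative (nf q).2.1))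
        = pair (fun k => wt α (k + 1)) (ev p.c₃₄) ((2 : ℂ) • Polynomial.divX (nf q).2.1) := by
      apply pair_shift
      intro k
      rw [Polynomial.coeff_smul, Polynomial.coeff_smul, Polynomial.coeff_divX,
        coeff_shiftEuler_derivative, wt_succ]
      push_cast [smul_eq_mul]; ring
    rw [this, pair_smul_left]
    simp only [pair, Polynomial.sum, Finset.mul_sum, Polynomial.coeff_smul, smul_eq_mul]
    exact Finset.sum_congr rfl fun k _ => by ring
  have ef : (nf p).2.1 = ev (pderiv 1 p.c) + -((2 : ℂ) • (Polynomial.X * ev p.c₃₄)) := by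
    simp [nf, Polynomial.smul_eq_C_mul, poly_C_two]; ring
  rw [e3, e4, e34, bfNF, ef, pair_add_left, pair_neg_left]
  simp only [nf, LinearMap.coe_mk, AddHom.coe_mk]
  ring

/-- Conjugation of the coefficients of a normal form. -/
def conjNF (f : NF) : NF :=
  (f.1.map (starRingEnd ℂ), f.2.1.map (starRingEnd ℂ), f.2.2.1.map (starRingEnd ℂ),
    f.2.2.2.map (starRingEnd ℂ))

theorem ev_map_conj (c : EvenPoly) :
    ev (map (starRingEnd ℂ) c) = (ev c).map (starRingEnd ℂ) := by
  induction c using MvPolynomial.induction_on with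
  | C a => simp [ev]
  | add p q hp hq => simp [hp, hq]
  | mul_X p i hp => fin_cases i <;> simp [hp, ev_X0, ev_X1]

theorem nf_conjPoly (q : SuperPoly) : nf (conjPoly q) = conjNF (nf q) := by
  have h : pderiv 1 (map (starRingEnd ℂ) q.c) = map (starRingEnd ℂ) (pderiv 1 q.c) := pderiv_map
  simp [nf, conjPoly, conjNF, ev_map_conj, h]

theorem bfSuper_eq (p q : SuperPoly) : bfSuper α p q = bfNF α (nf p) (conjNF (nf q)) := by
  rw [bfSuper, evalZero_besselSubst, nf_conjPoly]

theorem dρH₂_fockIdeal : fockIdeal ≤ fockIdeal.comap (dρH₂Super α) := by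
  intro p hp
  rw [fockIdeal_eq_ker, LinearMap.mem_ker] at hp
  rw [Submodule.mem_comap, fockIdeal_eq_ker, LinearMap.mem_ker]
  have hz : nf (z₁ * p) = 0 := nf_mul_left _ _ hp
  rw [dρH₂Super, LinearMap.sub_apply, map_sub, nf_bessel₁, hp]
  simp [mulOp, shiftEuler, hz, ← Prod.zero_eq_mk]

end NormalForm

/-! ### The polynomial Fock space, the Bessel-Fischer product and the fundamental symmetry -/

/-- The polynomial Fock space `P(ℂ^{2|2}) / 𝓘`. The parameter `α` only enters the inner product
with which this type is equipped below. -/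
def PolyFock (_α : ℝ) : Type := SuperPoly ⧸ fockIdeal

section Structure
variable (α : ℝ)

instance : AddCommGroup (PolyFock α) := inferInstanceAs (AddCommGroup (SuperPoly ⧸ fockIdeal))
instance : Module ℂ (PolyFock α) := inferInstanceAs (Module ℂ (SuperPoly ⧸ fockIdeal))

/-- The class of a superpolynomial. -/
def mk : SuperPoly →ₗ[ℂ] PolyFock α := fockIdeal.mkQ

/-- The operator `dρ(H₂)` on the polynomial Fock space. -/
def dρH₂ : Module.End ℂ (PolyFock α) := fockIdeal.mapQ fockIdeal (dρH₂Super α) (dρH₂_fockIdeal α)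

theorem dρH₂_mk (p : SuperPoly) :
    dρH₂ α (mk α p) = mk α (z₁ * p - bessel₁ α p) := rfl

theorem bfSuper_congr (p q p' q' : SuperPoly) (hp : fockIdeal.quotientRel p p')
    (hq : fockIdeal.quotientRel q q') : bfSuper α p q = bfSuper α p' q' := by
  rw [Submodule.quotientRel_def, fockIdeal_eq_ker, LinearMap.mem_ker, map_sub, sub_eq_zero] at hp hq
  rw [bfSuper_eq, bfSuper_eq, hp, hq]

/-- The Bessel-Fischer product on the polynomial Fock space, linear in the first argument. -/
def bf (x y : PolyFock α) : ℂ := Quotient.liftOn₂ x y (bfSuper α) (bfSuper_congr α)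

theorem bf_mk (p q : SuperPoly) : bf α (mk α p) (mk α q) = bfSuper α p q := rfl

/-- The isomorphism of the polynomial Fock space with the space of normal forms. -/
def nfEquiv : PolyFock α ≃ₗ[ℂ] NF :=
  LinearEquiv.ofBijective (fockIdeal.liftQ nf fockIdeal_le_ker) <| by
    constructor
    · rw [← LinearMap.ker_eq_bot]
      exact Submodule.ker_liftQ_eq_bot _ _ _ ker_le_fockIdeal
    · intro f
      exact ⟨Submodule.Quotient.mk (ofNF f), nf_ofNF f⟩

theorem nfEquiv_mk (p : SuperPoly) : nfEquiv α (mk α p) = nf p := rfl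

theorem bf_eq (x y : PolyFock α) : bf α x y = bfNF α (nfEquiv α x) (conjNF (nfEquiv α y)) := by
  obtain ⟨p, rfl⟩ := Submodule.mkQ_surjective fockIdeal x
  obtain ⟨q, rfl⟩ := Submodule.mkQ_surjective fockIdeal y
  exact bfSuper_eq α p q

/-- Multiplication of the `k`-th coefficient by `s k`. -/
def mulCoeff (s : ℕ → ℝ) : Polynomial ℂ →ₗ[ℂ] Polynomial ℂ :=
  Polynomial.lsum fun k => (s k : ℂ) • Polynomial.monomial k

theorem mulCoeff_monomial (s : ℕ → ℝ) (n : ℕ) (a : ℂ) :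
    mulCoeff s (Polynomial.monomial n a) = (s n : ℂ) • Polynomial.monomial n a := by
  simp [mulCoeff, Polynomial.lsum_apply, Polynomial.sum_monomial_index]

theorem coeff_mulCoeff (s : ℕ → ℝ) (f : Polynomial ℂ) (k : ℕ) :
    (mulCoeff s f).coeff k = s k * f.coeff k := by
  induction f using Polynomial.induction_on' with
  | add p q hp hq => simp [hp, hq, mul_add]
  | monomial n a =>
    rw [mulCoeff_monomial, Polynomial.coeff_smul, Polynomial.coeff_monomial]
    split_ifs with h
    · simp [h]
    · simp

/-- The sign of `(-α)_k`. -/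
def sgn (k : ℕ) : ℝ := Real.sign ((ascPochhammer ℝ k).eval (-α))

/-- The fundamental symmetry in normal form. -/
def symmNF : NF →ₗ[ℂ] NF where
  toFun f := (mulCoeff (sgn α) f.1, -mulCoeff (sgn α) f.2.1,
    -mulCoeff (fun k => sgn α (k + 1)) f.2.2.2, mulCoeff (fun k => sgn α (k + 1)) f.2.2.1)
  map_add' f g := by ext1 <;> simp [add_comm]
  map_smul' a f := by ext1 <;> simp

/-- The fundamental symmetry `S`; its values on the basis are given in the next four lemmas. -/
def symm : Module.End ℂ (PolyFock α) :=
  (nfEquiv α).symm.toLinearMap ∘ₗ symmNF α ∘ₗ (nfEquiv α).toLinearMap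

theorem nfEquiv_symm (x : PolyFock α) : nfEquiv α (symm α x) = symmNF α (nfEquiv α x) := by
  simp [symm]

theorem nf_z₁_pow_mul (k : ℕ) (p : SuperPoly) :
    nf (z₁ ^ k * p) = (Polynomial.X ^ k * (nf p).1, Polynomial.X ^ k * (nf p).2.1,
      Polynomial.X ^ k * (nf p).2.2.1, Polynomial.X ^ k * (nf p).2.2.2) := by
  induction k with
  | zero => simp
  | succ k ih =>
    have h : ∀ q, nf (z₁ * q) = (Polynomial.X * (nf q).1, Polynomial.X * (nf q).2.1,
        Polynomial.X * (nf q).2.2.1, Polynomial.X * (nf q).2.2.2) := by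
      intro q
      simp [nf, z₁, ev_X0, pderiv_X]; ring
    rw [pow_succ', mul_assoc, h, ih]
    simp [pow_succ', mul_assoc]

theorem symm_z₁_pow (k : ℕ) : symm α (mk α (z₁ ^ k)) = (sgn α k : ℂ) • mk α (z₁ ^ k) := by
  have h := nf_z₁_pow_mul k 1
  rw [mul_one] at h
  apply (nfEquiv α).injective
  rw [nfEquiv_symm, map_smul, nfEquiv_mk, h]
  simp [nf, symmNF, Polynomial.X_pow_eq_monomial, mulCoeff_monomial]

theorem symm_z₁_pow_z₂ (k : ℕ) :
    symm α (mk α (z₁ ^ k * z₂)) = -(sgn α k : ℂ) • mk α (z₁ ^ k * z₂) := by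
  apply (nfEquiv α).injective
  rw [nfEquiv_symm, map_smul, nfEquiv_mk, nf_z₁_pow_mul]
  simp [nf, symmNF, z₂, ev_X1, pderiv_X, Polynomial.X_pow_eq_monomial, mulCoeff_monomial]

theorem symm_z₁_pow_z₃ (k : ℕ) :
    symm α (mk α (z₁ ^ k * z₃)) = (sgn α (k + 1) : ℂ) • mk α (z₁ ^ k * z₄) := by
  apply (nfEquiv α).injective
  rw [nfEquiv_symm, map_smul, nfEquiv_mk, nfEquiv_mk, nf_z₁_pow_mul, nf_z₁_pow_mul]
  simp [nf, symmNF, z₃, z₄, Polynomial.X_pow_eq_monomial, mulCoeff_monomial]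

theorem symm_z₁_pow_z₄ (k : ℕ) :
    symm α (mk α (z₁ ^ k * z₄)) = -(sgn α (k + 1) : ℂ) • mk α (z₁ ^ k * z₃) := by
  apply (nfEquiv α).injective
  rw [nfEquiv_symm, map_smul, nfEquiv_mk, nfEquiv_mk, nf_z₁_pow_mul, nf_z₁_pow_mul]
  simp [nf, symmNF, z₃, z₄, Polynomial.X_pow_eq_monomial, mulCoeff_monomial]

/-- The form `(x, y)_S = ⟨x, S y⟩`. -/
def ipS (x y : PolyFock α) : ℂ := bf α x (symm α y)

theorem pair_mulCoeff (w s : ℕ → ℝ) (f g : Polynomial ℂ) :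
    pair w f ((mulCoeff s g).map (starRingEnd ℂ))
      = pair (fun k => w k * s k) f (g.map (starRingEnd ℂ)) := by
  apply pair_shift
  intro k
  rw [Polynomial.coeff_map, coeff_mulCoeff, Polynomial.coeff_map]
  simp [mul_assoc]

theorem pair_map_neg (w : ℕ → ℝ) (f g : Polynomial ℂ) :
    pair w f ((-g).map (starRingEnd ℂ)) = -pair w f (g.map (starRingEnd ℂ)) := by
  simp [pair, Polynomial.sum]

theorem ipS_eq (x y : PolyFock α) : ipS α x y =
    pair (fun k => wt α k * sgn α k) (nfEquiv α x).1 ((nfEquiv α y).1.map (starRingEnd ℂ))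
    + pair (fun k => wt α k * sgn α k) (nfEquiv α x).2.1 ((nfEquiv α y).2.1.map (starRingEnd ℂ))
    + pair (fun k => wtOdd α k * sgn α (k + 1)) (nfEquiv α x).2.2.1
        ((nfEquiv α y).2.2.1.map (starRingEnd ℂ))
    + pair (fun k => wtOdd α k * sgn α (k + 1)) (nfEquiv α x).2.2.2
        ((nfEquiv α y).2.2.2.map (starRingEnd ℂ)) := by
  rw [ipS, bf_eq, nfEquiv_symm]
  simp only [bfNF, conjNF, symmNF, LinearMap.coe_mk, AddHom.coe_mk, pair_map_neg, pair_mulCoeff]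
  ring

theorem pair_conj (w : ℕ → ℝ) (f g : Polynomial ℂ) :
    (starRingEnd ℂ) (pair w f (g.map (starRingEnd ℂ))) = pair w g (f.map (starRingEnd ℂ)) := by
  rw [pair_eq w f _ (max f.natDegree g.natDegree + 1) (by omega),
    pair_eq w g _ (max f.natDegree g.natDegree + 1) (by omega), map_sum]
  refine Finset.sum_congr rfl fun k _ => ?_
  simp [Polynomial.coeff_map]; ring

theorem pair_self (w : ℕ → ℝ) (f : Polynomial ℂ) :
    pair w f (f.map (starRingEnd ℂ))
      = ((∑ k ∈ Finset.range (f.natDegree + 1), w k * ‖f.coeff k‖ ^ 2 : ℝ) : ℂ) := by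
  rw [pair_eq w f _ _ (Nat.lt_succ_self _)]
  push_cast
  refine Finset.sum_congr rfl fun k _ => ?_
  rw [Polynomial.coeff_map, mul_comm (f.coeff k), mul_assoc, Complex.mul_conj,
    Complex.normSq_eq_norm_sq]
  push_cast; ring

theorem poch_ne_zero [hα : Fact (∀ n : ℕ, α ≠ n)] (k : ℕ) :
    (ascPochhammer ℝ k).eval (-α) ≠ 0 := by
  induction k with
  | zero => simp
  | succ k ih =>
    rw [ascPochhammer_succ_eval]
    refine mul_ne_zero ih fun h => hα.out k (by linarith)

theorem mul_sign_pos {x : ℝ} (hx : x ≠ 0) : 0 < x * Real.sign x := by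
  rcases lt_or_gt_of_ne hx with h | h
  · rw [Real.sign_of_neg h]; linarith
  · rw [Real.sign_of_pos h]; linarith

theorem wt_sgn_pos [Fact (∀ n : ℕ, α ≠ n)] (k : ℕ) : 0 < wt α k * sgn α k := by
  rw [wt, sgn, mul_assoc]
  exact mul_pos (by positivity) (mul_sign_pos (poch_ne_zero α k))

theorem wtOdd_sgn_pos [Fact (∀ n : ℕ, α ≠ n)] (k : ℕ) : 0 < wtOdd α k * sgn α (k + 1) := by
  rw [wtOdd, sgn, mul_assoc, mul_assoc]
  exact mul_pos two_pos (mul_pos (by positivity) (mul_sign_pos (poch_ne_zero α (k + 1))))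

theorem sum_eq_zero_iff_poly (w : ℕ → ℝ) (hw : ∀ k, 0 < w k) (f : Polynomial ℂ)
    (h : ∑ k ∈ Finset.range (f.natDegree + 1), w k * ‖f.coeff k‖ ^ 2 = 0) : f = 0 := by
  rw [Finset.sum_eq_zero_iff_of_nonneg (fun k _ => by have := hw k; positivity)] at h
  have h1 := h f.natDegree (by simp)
  simpa [(hw _).ne'] using h1

theorem sum_nonneg_poly (w : ℕ → ℝ) (hw : ∀ k, 0 < w k) (f : Polynomial ℂ) :
    0 ≤ ∑ k ∈ Finset.range (f.natDegree + 1), w k * ‖f.coeff k‖ ^ 2 :=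
  Finset.sum_nonneg fun k _ => by have := hw k; positivity

theorem pair_conj_aux (x y : PolyFock α) : (starRingEnd ℂ) (ipS α y x) = ipS α x y := by
  simp only [ipS_eq, map_add, pair_conj]

/-- The inner product `(·, ·)_S` on the polynomial Fock space, in Mathlib's convention: the inner
product is conjugate-linear in its first argument, so `⟪x, y⟫ = (y, x)_S`. -/
@[reducible]
def innerCore [Fact (∀ n : ℕ, α ≠ n)] : InnerProductSpace.Core ℂ (PolyFock α) where
  inner x y := ipS α y x
  conj_inner_symm x y := by
    simp only [ipS_eq, map_add, pair_conj]
  re_inner_nonneg x := by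
    simp only [ipS_eq, pair_self]
    rw [← Complex.ofReal_add, ← Complex.ofReal_add, ← Complex.ofReal_add, RCLike.re_eq_complex_re,
      Complex.ofReal_re]
    have h1 := sum_nonneg_poly _ (wt_sgn_pos α)
    have h2 := sum_nonneg_poly _ (wtOdd_sgn_pos α)
    exact add_nonneg (add_nonneg (add_nonneg (h1 _) (h1 _)) (h2 _)) (h2 _)
  add_left x y z := by
    rw [← pair_conj_aux α z (x + y), ← pair_conj_aux α z x, ← pair_conj_aux α z y, ← map_add]
    congr 1
    simp only [ipS_eq, map_add, Prod.fst_add, Prod.snd_add, pair_add_left]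
    ring
  smul_left x y a := by
    rw [← pair_conj_aux α y (a • x), ← pair_conj_aux α y x, ← map_mul]
    congr 1
    simp only [ipS_eq, map_smul, Prod.smul_fst, Prod.smul_snd, pair_smul_left]
    ring
  definite x h := by
    simp only [ipS_eq, pair_self] at h
    rw [← Complex.ofReal_add, ← Complex.ofReal_add, ← Complex.ofReal_add,
      Complex.ofReal_eq_zero] at h
    have n1 := sum_nonneg_poly _ (wt_sgn_pos α) (nfEquiv α x).1
    have n2 := sum_nonneg_poly _ (wt_sgn_pos α) (nfEquiv α x).2.1
    have n3 := sum_nonneg_poly _ (wtOdd_sgn_pos α) (nfEquiv α x).2.2.1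
    have n4 := sum_nonneg_poly _ (wtOdd_sgn_pos α) (nfEquiv α x).2.2.2
    apply (nfEquiv α).injective
    rw [map_zero]
    refine Prod.ext ?_ (Prod.ext ?_ (Prod.ext ?_ ?_))
    · exact sum_eq_zero_iff_poly _ (wt_sgn_pos α) _ (by linarith)
    · exact sum_eq_zero_iff_poly _ (wt_sgn_pos α) _ (by linarith)
    · exact sum_eq_zero_iff_poly _ (wtOdd_sgn_pos α) _ (by linarith)
    · exact sum_eq_zero_iff_poly _ (wtOdd_sgn_pos α) _ (by linarith)

end Structure

/-! ### The Fock space and the exponential of `dρ(H₂)` -/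

section Fock
variable (α : ℝ) [Fact (∀ n : ℕ, α ≠ n)]

instance : NormedAddCommGroup (PolyFock α) :=
  @InnerProductSpace.Core.toNormedAddCommGroup ℂ (PolyFock α) _ _ _ (innerCore α)

instance : InnerProductSpace ℂ (PolyFock α) := InnerProductSpace.ofCore (innerCore α).toCore

theorem inner_polyFock (x y : PolyFock α) : inner ℂ x y = bf α y (symm α x) := rfl

/-- The Fock space: the Hilbert space completion of the polynomial Fock space for `(·, ·)_S`. -/
abbrev Fock : Type := UniformSpace.Completion (PolyFock α)

/-- The continuous extension to the Fock space of the Bessel-Fischer product. -/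
def bfFock (f g : Fock α) : ℂ :=
  ((UniformSpace.Completion.isDenseInducing_coe (α := PolyFock α)).prodMap
    (UniformSpace.Completion.isDenseInducing_coe (α := PolyFock α))).extend
    (fun x : PolyFock α × PolyFock α => bf α x.1 x.2) (f, g)

/-- `U` is the one-parameter group `t ↦ exp(t dρ(H₂))`: a strongly continuous one-parameter group of
bounded operators on the Fock space whose infinitesimal generator is the closure of the operator
`dρ(H₂)`, defined on the polynomial Fock space. -/
structure IsExpGroup (U : ℝ → (Fock α →L[ℂ] Fock α)) : Prop where
  map_zero : U 0 = 1
  map_add : ∀ s t : ℝ, U (s + t) = U s * U t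
  continuous : ∀ f : Fock α, Continuous fun t : ℝ => U t f
  generator : ∀ f g : Fock α, HasDerivAt (fun t : ℝ => U t f) g 0 ↔
    (f, g) ∈ closure (Set.range fun p : PolyFock α => ((p : Fock α), (dρH₂ α p : Fock α)))

end Fock

end FockD21

end

open Filter Topology Set

/-! In normal form the polynomial Fock space is an orthogonal sum of four copies of `ℂ[z]`, and
`dρ(H₂)` acts on each as `A = z - (c + z d/dz) d/dz`, with `c = -α` on the classes of `z₁^k`, `z₁^k
z₂` and `c = 1 - α` on those of `z₁^k z₃`, `z₁^k z₄` (`nfEquiv_dρH₂`). Monomials are orthogonal, and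
their squared norms satisfy `w (k + 1) = |(c + k) (k + 1)| w k`. Thus `A` is a two-sided weighted
shift, and summation by parts shows that `Re ⟨A f, f⟩` only involves the defects `w (k + 1) - (c +
k) (k + 1) w k`. These vanish when `c + k > 0`. So at most finitely many survive, the symmetric part
of `A` is bounded (`quasiSkew_fockGenerator`), and it is zero for `α < 0`
(`quasiSkew_zero_fockGenerator`).

A bounded symmetric part gives an energy estimate `‖u t‖ ≤ exp (M |t|) ‖u 0‖` for solutions of `u' =
A u`, hence uniqueness of the group. For existence, `n` applications of `A` to a monomial cost at
most `C n! R ^ n`, with `R` independent of the monomial (`analyticVectors_fock`). The exponential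
series therefore converges for small `t`, the energy estimate makes it bounded, and the local group
extends to all of `ℝ`. Orbits of polynomials stay in the closure of the graph, which identifies the
generator with that closure (`isGroupWithGenerator_of_core`).

For `α < 0` the energy is conserved, so the group is unitary. Conversely, unitarity makes the
generator skew, and testing this on `1` and `z₁` gives `α + |α| = 0`. Finally, for `α < 0` the
Bessel-Fischer product is `(f, S⁻¹ g)_S`, where `S⁻¹` is isometric and commutes with `dρ(H₂)`, hence
with the group. -/

/-- `U` is a strongly continuous one-parameter group whose infinitesimal generator is the operator
with graph `Γ`. -/
structure IsGroupWithGenerator {H : Type*} [NormedAddCommGroup H] [InnerProductSpace ℂ H]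
    (Γ : Submodule ℂ (H × H)) (U : ℝ → (H →L[ℂ] H)) : Prop where
  map_zero : U 0 = 1
  map_add : ∀ s t : ℝ, U (s + t) = U s * U t
  continuous : ∀ f : H, Continuous fun t : ℝ => U t f
  generator : ∀ f g : H, HasDerivAt (fun t : ℝ => U t f) g 0 ↔ (f, g) ∈ Γ

/-! ### Energy estimates for solutions of the evolution equation. -/

section Growth

variable {H : Type*} [NormedAddCommGroup H] [InnerProductSpace ℂ H]

/-- Grönwall's argument: the derivative of `‖u‖²` is `2 Re ⟨v, u⟩ ≤ 2 M ‖u‖²`, so `exp (-2 M t) ‖u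
t‖²` is antitone. -/
theorem norm_le_exp_mul_of_hasDerivAt {u v : ℝ → H} {M T : ℝ} (hT : 0 ≤ T)
    (hu : ∀ t ∈ Icc 0 T, HasDerivAt u (v t) t)
    (hM : ∀ t ∈ Icc 0 T, (inner ℂ (v t) (u t)).re ≤ M * ‖u t‖ ^ 2) :
    ‖u T‖ ≤ Real.exp (M * T) * ‖u 0‖ := by
  have hsq : ∀ x : H, (inner ℂ x x).re = ‖x‖ ^ 2 := fun x => by
    simpa using inner_self_eq_norm_sq (𝕜 := ℂ) x
  have hd : ∀ t ∈ Icc 0 T, HasDerivAt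
      (fun s => Real.exp (-(2 * M) * s) * (inner ℂ (u s) (u s)).re)
      (Real.exp (-(2 * M) * t) * (-(2 * M)) * (inner ℂ (u t) (u t)).re
        + Real.exp (-(2 * M) * t) * (2 * (inner ℂ (v t) (u t)).re)) t := by
    intro t ht
    have h1 : HasDerivAt (fun s : ℝ => Real.exp (-(2 * M) * s))
        (Real.exp (-(2 * M) * t) * (-(2 * M))) t := by
      simpa using ((hasDerivAt_id t).const_mul (-(2 * M))).exp
    have h2 := (hu t ht).inner ℂ (hu t ht)
    have h3 := Complex.reCLM.hasFDerivAt.comp_hasDerivAt t h2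
    have h4 : (inner ℂ (u t) (v t)).re = (inner ℂ (v t) (u t)).re := by
      rw [← inner_conj_symm, Complex.conj_re]
    have h5 : Complex.reCLM (inner ℂ (u t) (v t) + inner ℂ (v t) (u t))
        = 2 * (inner ℂ (v t) (u t)).re := by
      simp only [Complex.reCLM_apply, Complex.add_re, h4]; ring
    rw [h5] at h3
    exact h1.mul h3
  have hanti : AntitoneOn (fun s => Real.exp (-(2 * M) * s) * (inner ℂ (u s) (u s)).re)
      (Icc 0 T) := by
    refine antitoneOn_of_deriv_nonpos (convex_Icc 0 T)
      (fun t ht => (hd t ht).continuousAt.continuousWithinAt)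
      (fun t ht => (hd t (interior_subset ht)).differentiableAt.differentiableWithinAt) ?_
    intro t ht
    rw [(hd t (interior_subset ht)).deriv, hsq]
    have h1 := hM t (interior_subset ht)
    have h2 := Real.exp_pos (-(2 * M) * t)
    nlinarith
  have h := hanti (left_mem_Icc.2 hT) (right_mem_Icc.2 hT) hT
  simp only [hsq, mul_zero, Real.exp_zero, one_mul] at h
  refine abs_le_of_sq_le_sq' ?_ (by positivity) |>.2
  have he : Real.exp (-(2 * M) * T) * Real.exp (M * T) ^ 2 = 1 := by
    rw [pow_two, ← Real.exp_add, ← Real.exp_add, Real.exp_eq_one_iff]; ring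
  calc ‖u T‖ ^ 2 = Real.exp (M * T) ^ 2 * (Real.exp (-(2 * M) * T) * ‖u T‖ ^ 2) := by
        rw [← mul_assoc, mul_comm (Real.exp (M * T) ^ 2), he, one_mul]
    _ ≤ Real.exp (M * T) ^ 2 * ‖u 0‖ ^ 2 := by gcongr
    _ = _ := by ring

/-- A relation is quasi-skew with bound `M` if `|Re ⟨g, f⟩| ≤ M ‖f‖²` for all `(f, g)` in it. -/
def QuasiSkew (Γ : Submodule ℂ (H × H)) (M : ℝ) : Prop :=
  ∀ p ∈ Γ, |(inner ℂ p.2 p.1).re| ≤ M * ‖p.1‖ ^ 2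

/-- Since the bound on `Re ⟨g, f⟩` is two-sided, the reversed curve `t ↦ u (-t)`, with velocity `-v
(-t)`, obeys the same estimate. This covers negative times. -/
theorem QuasiSkew.norm_le {Γ : Submodule ℂ (H × H)} {M : ℝ} (hΓ : QuasiSkew Γ M) {u v : ℝ → H}
    (T : ℝ) (hu : ∀ t, |t| ≤ |T| → HasDerivAt u (v t) t) (hm : ∀ t, |t| ≤ |T| → (u t, v t) ∈ Γ) :
    ‖u T‖ ≤ Real.exp (M * |T|) * ‖u 0‖ := by
  rcases le_total 0 T with h | h
  · rw [abs_of_nonneg h] at *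
    refine norm_le_exp_mul_of_hasDerivAt (v := v) h (fun t ht => hu t ?_) fun t ht => ?_
    · rw [abs_of_nonneg ht.1]; exact ht.2
    · exact (le_abs_self _).trans (hΓ _ (hm t (by rw [abs_of_nonneg ht.1]; exact ht.2)))
  · rw [abs_of_nonpos h] at *
    have := norm_le_exp_mul_of_hasDerivAt (u := fun t => u (-t)) (v := fun t => -v (-t)) (M := M)
      (T := -T) (by linarith) (fun t ht => ?_) fun t ht => ?_
    · simpa using this
    · have h1 := hu (-t) (by rw [abs_neg, abs_of_nonneg ht.1]; exact ht.2)
      have h2 := h1.scomp t (hasDerivAt_neg t)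
      rw [neg_one_smul] at h2
      exact h2
    · have h1 := hΓ _ (hm (-t) (by rw [abs_neg, abs_of_nonneg ht.1]; exact ht.2))
      rw [inner_neg_left, Complex.neg_re]
      exact (neg_le_abs _).trans h1

end Growth

/-! ### Uniqueness, intertwining and unitarity of groups with a quasi-skew generator. -/

namespace IsGroupWithGenerator

variable {H : Type*} [NormedAddCommGroup H] [InnerProductSpace ℂ H]
  {Γ Γ' : Submodule ℂ (H × H)} {U U' : ℝ → (H →L[ℂ] H)}

theorem hasDerivAt (h : IsGroupWithGenerator Γ U) {f g : H} (hfg : (f, g) ∈ Γ) (t : ℝ) :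
    HasDerivAt (fun s => U s f) (U t g) t := by
  have h0 := (h.generator f g).2 hfg
  have h1 : HasDerivAt (fun s => U (s - t) f) g t := by
    have := HasDerivAt.comp_sub_const t t (by simpa using h0)
    simpa using this
  have h2 := ((U t).restrictScalars ℝ).hasFDerivAt.comp_hasDerivAt t h1
  refine h2.congr_of_eventuallyEq (Eventually.of_forall fun s => ?_)
  show U s f = U t (U (s - t) f)
  rw [← mul_apply_eq_comp, ← h.map_add, add_sub_cancel]

/-- `U t` commutes with every `U s`, so it may be applied to the difference quotients at `0`. -/
theorem map_mem (h : IsGroupWithGenerator Γ U) {f g : H} (hfg : (f, g) ∈ Γ) (t : ℝ) :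
    (U t f, U t g) ∈ Γ := by
  rw [← h.generator]
  have h2 := ((U t).restrictScalars ℝ).hasFDerivAt.comp_hasDerivAt 0 ((h.generator f g).2 hfg)
  refine h2.congr_of_eventuallyEq (Eventually.of_forall fun s => ?_)
  show U s (U t f) = U t (U s f)
  rw [← mul_apply_eq_comp, ← mul_apply_eq_comp, ← h.map_add, ← h.map_add,
    add_comm]

theorem norm_apply_le {M : ℝ} (h : IsGroupWithGenerator Γ U) (hΓ : QuasiSkew Γ M)
    (hd : Dense {f | ∃ g, (f, g) ∈ Γ}) (t : ℝ) (f : H) :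
    ‖U t f‖ ≤ Real.exp (M * |t|) * ‖f‖ := by
  refine hd.induction (P := fun f => ‖U t f‖ ≤ Real.exp (M * |t|) * ‖f‖) ?_
    (isClosed_le (by fun_prop) (by fun_prop)) f
  rintro f ⟨g, hfg⟩
  have := hΓ.norm_le (u := fun s => U s f) (v := fun s => U s g) t
    (fun s _ => h.hasDerivAt hfg s) (fun s _ => h.map_mem hfg s)
  simpa [h.map_zero] using this

/-- The difference of the orbits `T (U s f)` and `U' s (T f)` is a solution in `Γ` that starts at
`0`, and the energy estimate forces it to vanish. The case `T = 1` is uniqueness; `T = S⁻¹` yields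
invariance of the Bessel-Fischer product. -/
theorem intertwine {M : ℝ} (h : IsGroupWithGenerator Γ U) (h' : IsGroupWithGenerator Γ U')
    (hΓ : QuasiSkew Γ M) (hd : Dense {f | ∃ g, (f, g) ∈ Γ}) {T : H →L[ℂ] H}
    (hT : ∀ f g, (f, g) ∈ Γ → (T f, T g) ∈ Γ) (t : ℝ) (f : H) :
    T (U t f) = U' t (T f) := by
  refine hd.induction (P := fun f => T (U t f) = U' t (T f)) ?_
    (isClosed_eq (by fun_prop) (by fun_prop)) f
  rintro f ⟨g, hfg⟩
  have := hΓ.norm_le (u := fun s => T (U s f) - U' s (T f)) (v := fun s => T (U s g) - U' s (T g)) t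
    (fun s _ => ?_) (fun s _ => ?_)
  · simpa [h.map_zero, h'.map_zero, sub_eq_zero] using this
  · exact ((T.restrictScalars ℝ).hasFDerivAt.comp_hasDerivAt s (h.hasDerivAt hfg s)).sub
      (h'.hasDerivAt (hT f g hfg) s)
  · exact Γ.sub_mem (hT _ _ (h.map_mem hfg s)) (h'.map_mem (hT _ _ hfg) s)

theorem unique {M : ℝ} (h : IsGroupWithGenerator Γ U) (h' : IsGroupWithGenerator Γ U')
    (hΓ : QuasiSkew Γ M) (hd : Dense {f | ∃ g, (f, g) ∈ Γ}) : U = U' := by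
  funext t
  ext f
  exact h.intertwine h' hΓ hd (T := 1) (fun _ _ h => h) t f

/-- With `M = 0` both `U t` and its inverse `U (-t)` are contractions. -/
theorem norm_apply_eq (h : IsGroupWithGenerator Γ U) (hΓ : QuasiSkew Γ 0)
    (hd : Dense {f | ∃ g, (f, g) ∈ Γ}) (t : ℝ) (f : H) : ‖U t f‖ = ‖f‖ := by
  refine le_antisymm (by simpa using h.norm_apply_le hΓ hd t f) ?_
  have := h.norm_apply_le hΓ hd (-t) (U t f)
  rw [← mul_apply_eq_comp, ← h.map_add] at this
  simpa [h.map_zero] using this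

theorem mem_unitary [CompleteSpace H] (h : IsGroupWithGenerator Γ U) (hΓ : QuasiSkew Γ 0)
    (hd : Dense {f | ∃ g, (f, g) ∈ Γ}) (t : ℝ) : U t ∈ unitary (H →L[ℂ] H) := by
  have h1 : star (U t) * U t = 1 :=
    (ContinuousLinearMap.norm_map_iff_adjoint_comp_self (U t)).1 (h.norm_apply_eq hΓ hd t)
  have h2 : U t * U (-t) = 1 := by rw [← h.map_add, add_neg_cancel, h.map_zero]
  have h3 : star (U t) = U (-t) := left_inv_eq_right_inv h1 h2
  exact Unitary.mem_iff.2 ⟨h1, by rw [h3, h2]⟩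

/-- The generator of a unitary group is skew-symmetric. -/
theorem inner_add_inner_eq_zero [CompleteSpace H] (h : IsGroupWithGenerator Γ U)
    (hU : ∀ t, U t ∈ unitary (H →L[ℂ] H)) {f g f' g' : H} (hf : (f, g) ∈ Γ) (hf' : (f', g') ∈ Γ) :
    inner ℂ f g' + inner ℂ g f' = 0 := by
  have h1 := ((h.generator _ _).2 hf).inner ℂ ((h.generator _ _).2 hf')
  simp only [h.map_zero, one_apply_eq_self] at h1
  -- Unitarity makes `⟨U t f, U t f'⟩` constant, so its derivative at `0` vanishes.
  refine h1.unique ((hasDerivAt_const (0 : ℝ) (inner ℂ f f')).congr_of_eventuallyEq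
    (Eventually.of_forall fun t => ?_))
  exact ContinuousLinearMap.inner_map_map_of_mem_unitary (hU t) f f'

end IsGroupWithGenerator

/-! ### Extension of a local one-parameter group to the whole line. -/

/-- A local homomorphism from `ℝ` to a monoid extends to a homomorphism. -/
theorem exists_hom_of_local_hom {G : Type*} [Monoid G] {V : ℝ → G} {ρ : ℝ} (hρ : 0 < ρ)
    (h0 : V 0 = 1)
    (hV : ∀ s t, |s| < ρ → |t| < ρ → |s + t| < ρ → V (s + t) = V s * V t) :
    ∃ U : ℝ → G, (∀ s t, U (s + t) = U s * U t) ∧ ∀ t, |t| < ρ → U t = V t := by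
  have hpow : ∀ (k : ℕ) (s : ℝ), |k * s| < ρ → V (k * s) = V s ^ k := by
    intro k s
    induction k with
    | zero => intro _; simp [h0]
    | succ k ih =>
      intro hk
      have e : ((k + 1 : ℕ) : ℝ) * s = k * s + s := by push_cast; ring
      have a : |((k + 1 : ℕ) : ℝ) * s| = k * |s| + |s| := by
        rw [abs_mul, Nat.abs_cast]; push_cast; ring
      have b : |(k : ℝ) * s| = k * |s| := by rw [abs_mul, Nat.abs_cast]
      have hs := abs_nonneg s
      have hks : 0 ≤ (k : ℝ) * |s| := by positivity
      have hk1 : |(k : ℝ) * s| < ρ := by rw [b]; rw [a] at hk; linarith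
      rw [pow_succ, ← ih hk1, e]
      rw [e] at hk
      exact hV _ _ hk1 (by rw [← e, a] at hk; linarith) hk
  have hdiv : ∀ (m n : ℕ) (t : ℝ), 0 < m → 0 < n → |t / m| < ρ →
      V (t / m) ^ m = V (t / (m * n : ℕ)) ^ (m * n) := by
    intro m n t hm hn ht
    have hm' : (m : ℝ) ≠ 0 := by positivity
    have hn' : (n : ℝ) ≠ 0 := by positivity
    have e : t / m = n * (t / (m * n : ℕ)) := by push_cast; field_simp
    rw [e] at ht ⊢
    rw [hpow _ _ ht, ← pow_mul, mul_comm n m]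
  -- Both powers agree with the one for the common subdivision of `t` into `m * n` pieces.
  have hindep : ∀ (m n : ℕ) (t : ℝ), 0 < m → 0 < n → |t / m| < ρ → |t / n| < ρ →
      V (t / m) ^ m = V (t / n) ^ n := by
    intro m n t hm hn h1 h2
    rw [hdiv m n t hm hn h1, hdiv n m t hn hm h2, mul_comm]
  have hlt : ∀ (t C : ℝ), |t| ≤ C → |t / (⌊C / ρ⌋₊ + 1 : ℕ)| < ρ := by
    intro t C ht
    rw [abs_div, Nat.abs_cast, div_lt_iff₀ (by positivity)]
    have := Nat.lt_floor_add_one (C / ρ)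
    rw [div_lt_iff₀ hρ] at this
    push_cast
    linarith
  -- The summand `1` in the number of pieces makes each piece strictly shorter than `ρ`, and keeps
  -- the number positive.
  refine ⟨fun t => V (t / (⌊|t| / ρ⌋₊ + 1 : ℕ)) ^ (⌊|t| / ρ⌋₊ + 1), fun s t => ?_, fun t ht => ?_⟩
  -- A subdivision fine enough for `|s| + |t|` serves `s`, `t` and `s + t` at once.
  · obtain ⟨m, hm⟩ : ∃ m : ℕ, m = ⌊(|s| + |t|) / ρ⌋₊ + 1 := ⟨_, rfl⟩
    have hm0 : 0 < m := by omega
    have hs : |s / m| < ρ := by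
      rw [hm]; exact hlt s _ (by linarith [abs_nonneg t])
    have ht : |t / m| < ρ := by
      rw [hm]; exact hlt t _ (by linarith [abs_nonneg s])
    have hst : |(s + t) / m| < ρ := by
      rw [hm]; exact hlt (s + t) _ (abs_add_le s t)
    show V _ ^ _ = V _ ^ _ * V _ ^ _
    rw [hindep _ m (s + t) (by omega) hm0 (hlt _ _ le_rfl) hst,
      hindep _ m s (by omega) hm0 (hlt _ _ le_rfl) hs,
      hindep _ m t (by omega) hm0 (hlt _ _ le_rfl) ht]
    rw [add_div] at hst ⊢
    -- The local law, read in both orders, shows that the pieces commute; so the `m`-th power of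
    -- their product splits.
    have hc : Commute (V (s / m)) (V (t / m)) := by
      show _ * _ = _ * _
      rw [← hV _ _ hs ht hst, ← hV _ _ ht hs (by rwa [add_comm]), add_comm]
    rw [hV _ _ hs ht hst, hc.mul_pow]
  · have := hindep (⌊|t| / ρ⌋₊ + 1) 1 t (by omega) one_pos (hlt _ _ le_rfl) (by simpa using ht)
    simpa using this

/-! ### Analytic vectors and the exponential series for small times. -/

section LocalExp

variable {P H : Type*} [AddCommGroup P] [Module ℂ P] [NormedAddCommGroup H]
  [InnerProductSpace ℂ H] (ι : P →ₗ[ℂ] H) (A : Module.End ℂ P)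

/-- The closure of the graph of the densely defined operator `A`. -/
def graphClosure : Submodule ℂ (H × H) := (LinearMap.range (ι.prod (ι ∘ₗ A))).topologicalClosure

theorem mem_graphClosure (p : P) : (ι p, ι (A p)) ∈ graphClosure ι A :=
  subset_closure ⟨p, rfl⟩

theorem isClosed_graphClosure : IsClosed (graphClosure ι A : Set (H × H)) := isClosed_closure

variable {ι A} in
-- Closed conditions pass from the graph on the dense domain to its closure.
theorem graphClosure_induction {Q : H → H → Prop} (hcl : IsClosed {x : H × H | Q x.1 x.2})
    (hQ : ∀ p, Q (ι p) (ι (A p))) {f g : H} (hfg : (f, g) ∈ graphClosure ι A) : Q f g :=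
  closure_minimal (t := {x : H × H | Q x.1 x.2}) (by rintro _ ⟨p, rfl⟩; exact hQ p) hcl hfg

variable {ι A} in
theorem dense_domain (hι : DenseRange ι) : Dense {f | ∃ g, (f, g) ∈ graphClosure ι A} :=
  Dense.mono (by rintro _ ⟨p, rfl⟩; exact ⟨_, mem_graphClosure ι A p⟩) hι

variable {ι A} in
theorem quasiSkew_graphClosure {M : ℝ}
    (h : ∀ p, |(inner ℂ (ι (A p)) (ι p)).re| ≤ M * ‖ι p‖ ^ 2) : QuasiSkew (graphClosure ι A) M := by
  rintro ⟨f, g⟩ hfg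
  refine graphClosure_induction (Q := fun f g => |(inner ℂ g f).re| ≤ M * ‖f‖ ^ 2) ?_ h hfg
  exact isClosed_le ((Complex.continuous_re.comp (by fun_prop)).abs) (by fun_prop)

/-- Every vector of the domain is analytic, with radius of convergence at least `1 / R`. -/
def AnalyticVectors (R : ℝ) : Prop :=
  ∀ p, ∃ C, ∀ n : ℕ, ‖ι ((A ^ n) p)‖ ≤ C * n.factorial * R ^ n

/-- The exponential series `∑ tⁿ Aⁿ p / n!`. -/
noncomputable def expSeries (t : ℝ) (p : P) : H := ∑' n : ℕ, (t ^ n / n.factorial) • ι ((A ^ n) p)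

variable {ι A} {R : ℝ}

/-- The factorial in the growth of `A ^ n` cancels the one in the series, leaving a geometric
majorant. -/
theorem AnalyticVectors.exists_bound (h : AnalyticVectors ι A R) (hR : 0 < R) (p : P) :
    ∃ C, 0 ≤ C ∧ ∀ (n : ℕ) (t : ℝ),
      ‖(t ^ n / n.factorial) • ι ((A ^ n) p)‖ ≤ C * (|t| * R) ^ n := by
  obtain ⟨C, hC⟩ := h p
  have h0 : 0 ≤ C := by simpa using (norm_nonneg _).trans (hC 0)
  refine ⟨C, h0, fun n t => ?_⟩
  have hn : (0 : ℝ) < n.factorial := by positivity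
  rw [norm_smul, Real.norm_eq_abs, abs_div, abs_pow, abs_of_pos hn, mul_pow]
  calc |t| ^ n / n.factorial * ‖ι ((A ^ n) p)‖
      ≤ |t| ^ n / n.factorial * (C * n.factorial * R ^ n) := by gcongr; exact hC n
    _ = C * (|t| ^ n * R ^ n) := by field_simp

theorem AnalyticVectors.summable (h : AnalyticVectors ι A R) [CompleteSpace H] (hR : 0 < R) {t : ℝ}
    (ht : |t| * R < 1) (p : P) : Summable fun n : ℕ => (t ^ n / n.factorial) • ι ((A ^ n) p) := by
  obtain ⟨C, -, hC⟩ := h.exists_bound hR p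
  exact Summable.of_norm_bounded ((summable_geometric_of_lt_one (by positivity) ht).mul_left C)
    fun n => hC n t

theorem expSeries_zero (p : P) : expSeries ι A 0 p = ι p := by
  rw [expSeries, tsum_eq_single 0]
  · simp
  · intro n hn; simp [hn]

theorem pow_apply_apply (n : ℕ) (p : P) : (A ^ n) (A p) = (A ^ (n + 1)) p := by
  rw [pow_succ, Module.End.mul_apply]

/-- Termwise differentiation on the ball of radius `1 / (2 R)`: the `n`-th term differentiates to
term `n - 1` of the series for `A p`, which is dominated by `C (1 / 2) ^ (n - 1)`. -/
theorem AnalyticVectors.hasDerivAt [CompleteSpace H] (h : AnalyticVectors ι A R) (hR : 0 < R) {t : ℝ}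
    (ht : |t| * R < 1 / 2) (p : P) :
    HasDerivAt (fun s => expSeries ι A s p) (expSeries ι A t (A p)) t := by
  obtain ⟨C, hC0, hC⟩ := h.exists_bound hR (A p)
  have hB : Metric.ball (0 : ℝ) (1 / 2 / R) = {s | |s| * R < 1 / 2} := by
    ext s; simp [lt_div_iff₀ hR]
  have key := hasDerivAt_tsum_of_isPreconnected (𝕜 := ℝ) (t := Metric.ball (0 : ℝ) (1 / 2 / R))
    (y₀ := 0)
    (y := t) (u := fun n : ℕ => C * (1 / 2) ^ (n - 1))
    (g := fun (n : ℕ) s => (s ^ n / n.factorial) • ι ((A ^ n) p))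
    (g' := fun (n : ℕ) s => ((n : ℝ) * s ^ (n - 1) / n.factorial) • ι ((A ^ n) p))
    ?_ Metric.isOpen_ball (convex_ball _ _).isPreconnected ?_ ?_ ?_ ?_ ?_
  · rw [tsum_eq_zero_add'] at key
    · refine key.congr_deriv ?_
      simp only [Nat.cast_zero, zero_mul, zero_div, zero_smul, zero_add, expSeries]
      refine tsum_congr fun n => ?_
      rw [pow_apply_apply, Nat.add_sub_cancel, Nat.factorial_succ]
      congr 1
      push_cast
      field_simp
    · refine (h.summable hR (t := t) (by linarith) (A p)).congr fun n => ?_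
      rw [pow_apply_apply, Nat.add_sub_cancel, Nat.factorial_succ]
      congr 1
      push_cast
      field_simp
  · refine Summable.mul_left C ((summable_nat_add_iff 1).1 ?_)
    exact summable_geometric_of_lt_one (by norm_num) (by norm_num)
  · intro n s _
    exact ((hasDerivAt_pow n s).div_const _).smul_const _
  · intro n s hs
    rw [hB] at hs
    -- For `n = 0` the derivative is zero, while truncated subtraction makes the majorant `C`.
    rcases n with _ | n
    · simp [hC0]
    · have e : ((n + 1 : ℕ) : ℝ) * s ^ n / (n + 1).factorial = s ^ n / n.factorial := by
        rw [Nat.factorial_succ]; push_cast; field_simp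
      rw [Nat.add_sub_cancel, e, ← pow_apply_apply]
      refine (hC n s).trans ?_
      gcongr
      exact le_of_lt hs
  · simp [hR]
  · exact h.summable hR (by simp) p
  · rw [hB]; exact ht

/-- Partial sums are vectors of the domain, and `A` sends them to the partial sums of the series for
`A p`; both converge, and the closure of the graph is closed. -/
theorem AnalyticVectors.mem_graphClosure [CompleteSpace H] (h : AnalyticVectors ι A R) (hR : 0 < R)
    {t : ℝ} (ht : |t| * R < 1) (p : P) :
    (expSeries ι A t p, expSeries ι A t (A p)) ∈ graphClosure ι A := by
  have h1 := (h.summable hR ht p).hasSum.tendsto_sum_nat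
  have h2 := (h.summable hR ht (A p)).hasSum.tendsto_sum_nat
  refine (isClosed_graphClosure ι A).mem_of_tendsto (h1.prodMk_nhds h2)
    (Eventually.of_forall fun N => ?_)
  have hsmul : ∀ (r : ℝ) (x : P), r • ι x = ι ((r : ℂ) • x) := fun r x => by
    rw [map_smul]; rfl
  have e : (∑ n ∈ Finset.range N, (t ^ n / n.factorial) • ι ((A ^ n) p),
      ∑ n ∈ Finset.range N, (t ^ n / n.factorial) • ι ((A ^ n) (A p)))
      = (ι (∑ n ∈ Finset.range N, ((t ^ n / n.factorial : ℝ) : ℂ) • (A ^ n) p),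
        ι (A (∑ n ∈ Finset.range N, ((t ^ n / n.factorial : ℝ) : ℂ) • (A ^ n) p))) := by
    simp only [map_sum, map_smul A, hsmul]
    simp only [pow_apply_apply, pow_succ', Module.End.mul_apply]
  rw [e]
  exact _root_.mem_graphClosure ι A _

/-- The majorant of the series depends on `p` through more than its norm. The energy estimate
replaces it by a multiple of `‖ι p‖`, which permits extension by continuity. -/
theorem AnalyticVectors.norm_expSeries_le [CompleteSpace H] (h : AnalyticVectors ι A R) (hR : 0 < R)
    {M : ℝ} (hΓ : QuasiSkew (graphClosure ι A) M) {t : ℝ} (ht : |t| * R < 1 / 2) (p : P) :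
    ‖expSeries ι A t p‖ ≤ Real.exp (M * |t|) * ‖ι p‖ := by
  have := hΓ.norm_le (u := fun s => expSeries ι A s p) (v := fun s => expSeries ι A s (A p)) t
    (fun s hs => h.hasDerivAt hR ?_ p) (fun s hs => h.mem_graphClosure hR ?_ p)
  · simpa [expSeries_zero] using this
  · nlinarith
  · nlinarith

/-- The exponential series as a linear map on the vectors of the domain. -/
noncomputable def AnalyticVectors.expLinear [CompleteSpace H] (h : AnalyticVectors ι A R) (hR : 0 < R)
    {t : ℝ} (ht : |t| * R < 1) : P →ₗ[ℂ] H where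
  toFun := expSeries ι A t
  map_add' p q := by
    rw [expSeries, expSeries, expSeries, ← (h.summable hR ht p).tsum_add (h.summable hR ht q)]
    exact tsum_congr fun n => by rw [map_add, map_add, smul_add]
  map_smul' c p := by
    rw [expSeries, expSeries, RingHom.id_apply, ← (h.summable hR ht p).tsum_const_smul]
    exact tsum_congr fun n => by rw [map_smul, map_smul, smul_comm]

theorem AnalyticVectors.exists_local [CompleteSpace H] (h : AnalyticVectors ι A R) (hR : 0 < R)
    (hι : DenseRange ι) {M : ℝ} (hΓ : QuasiSkew (graphClosure ι A) M) {t : ℝ}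
    (ht : |t| * R < 1 / 2) :
    ∃ V : H →L[ℂ] H, ∀ p, V (ι p) = expSeries ι A t p :=
  ⟨(h.expLinear hR (by linarith)).extendOfNorm ι, fun p =>
    LinearMap.extendOfNorm_eq hι ⟨_, h.norm_expSeries_le hR hΓ ht⟩ p⟩

theorem add_pow_div_factorial (s t : ℝ) (N : ℕ) : (s + t) ^ N / N.factorial
    = ∑ x ∈ Finset.HasAntidiagonal.antidiagonal N, s ^ x.1 / x.1.factorial * (t ^ x.2 / x.2.factorial) := by
  rw [(Commute.all s t).add_pow', Finset.sum_div]
  refine Finset.sum_congr rfl fun x hx => ?_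
  rw [← Finset.HasAntidiagonal.mem_antidiagonal.1 hx, nsmul_eq_mul]
  have h := Nat.add_choose_mul_factorial_mul_factorial x.1 x.2
  have h' : ((x.1 + x.2).factorial : ℝ)
      = (x.1 + x.2).choose x.1 * x.1.factorial * x.2.factorial := by
    rw [← h, Nat.choose_symm_add]; push_cast; ring
  have h0 : ((x.1 + x.2).choose x.1 : ℝ) ≠ 0 := by
    exact_mod_cast (Nat.choose_pos (Nat.le_add_right _ _)).ne'
  rw [h']
  field_simp

/-- The inequality `(n + m)! ≤ 2 ^ (n + m) n! m!` costs a factor `2` in each ratio; hence the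
restriction to times with `|t| * R < 1 / 2`. -/
theorem AnalyticVectors.summable_prod [CompleteSpace H] (h : AnalyticVectors ι A R) (hR : 0 < R)
    {s t : ℝ} (hs : |s| * R < 1 / 2) (ht : |t| * R < 1 / 2) (p : P) :
    Summable fun x : ℕ × ℕ => (t ^ x.1 / x.1.factorial * (s ^ x.2 / x.2.factorial)) •
      ι ((A ^ (x.1 + x.2)) p) := by
  obtain ⟨C, hC⟩ := h p
  have hsum : Summable fun x : ℕ × ℕ => (2 * (|t| * R)) ^ x.1 * (2 * (|s| * R)) ^ x.2 :=
    Summable.mul_of_nonneg (f := fun n : ℕ => (2 * (|t| * R)) ^ n)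
      (g := fun n : ℕ => (2 * (|s| * R)) ^ n)
      (summable_geometric_of_lt_one (by positivity) (by linarith))
      (summable_geometric_of_lt_one (by positivity) (by linarith))
      (fun n => by positivity) (fun n => by positivity)
  refine Summable.of_norm_bounded (hsum.mul_left C) fun x => ?_
  obtain ⟨n, m⟩ := x
  have h0 : 0 ≤ C := by simpa using (norm_nonneg _).trans (hC 0)
  have h1 : ((n + m).factorial : ℝ) ≤ 2 ^ (n + m) * (n.factorial * m.factorial) := by
    have h2 := Nat.add_choose_mul_factorial_mul_factorial n m
    rw [← h2, mul_assoc]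
    exact_mod_cast Nat.mul_le_mul_right _ (Nat.choose_le_two_pow _ _)
  simp only [norm_smul, Real.norm_eq_abs, abs_mul, abs_div, abs_pow, Nat.abs_cast]
  calc |t| ^ n / n.factorial * (|s| ^ m / m.factorial) * ‖ι ((A ^ (n + m)) p)‖
      ≤ |t| ^ n / n.factorial * (|s| ^ m / m.factorial) *
        (C * (2 ^ (n + m) * (n.factorial * m.factorial)) * R ^ (n + m)) := by
        gcongr
        refine (hC (n + m)).trans ?_
        gcongr
    _ = C * ((2 * (|t| * R)) ^ n * (2 * (|s| * R)) ^ m) := by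
        field_simp
        ring

/-- The sum of the series need not come from the domain, so `V` is applied term by term. The
absolutely convergent double series is then summed along antidiagonals, where the binomial theorem
produces `(s + t) ^ N / N!`. -/
theorem AnalyticVectors.map_expSeries [CompleteSpace H] (h : AnalyticVectors ι A R) (hR : 0 < R)
    {s t : ℝ} (hs : |s| * R < 1 / 2) (ht : |t| * R < 1 / 2) {V : H →L[ℂ] H}
    (hV : ∀ p, V (ι p) = expSeries ι A s p) (p : P) :
    V (expSeries ι A t p) = expSeries ι A (s + t) p := by
  have hsum := h.summable_prod hR hs ht p
  have e1 : V (expSeries ι A t p) = ∑' (n : ℕ) (m : ℕ),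
      (t ^ n / n.factorial * (s ^ m / m.factorial)) • ι ((A ^ (n + m)) p) := by
    rw [expSeries, ContinuousLinearMap.map_tsum V (h.summable hR (by linarith) p)]
    refine tsum_congr fun n => ?_
    rw [V.map_smul_of_tower, hV, expSeries,
      ← (h.summable hR (t := s) (by linarith) ((A ^ n) p)).tsum_const_smul]
    refine tsum_congr fun m => ?_
    rw [smul_smul, ← Module.End.mul_apply, ← pow_add, add_comm m n]
  rw [e1, ← hsum.tsum_prod' fun n => hsum.prod_factor n,
    ← Finset.HasAntidiagonal.sigmaAntidiagonalEquivProd.tsum_eq]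
  have hsum' := Finset.HasAntidiagonal.sigmaAntidiagonalEquivProd.summable_iff.2 hsum
  refine (Summable.tsum_sigma' (fun n => (hasSum_fintype (L := .unconditional _) _).summable)
    hsum').trans ?_
  rw [expSeries]
  refine tsum_congr fun N => ?_
  rw [tsum_fintype, add_comm s t, add_pow_div_factorial, Finset.sum_smul]
  refine Eq.trans ?_ (Finset.sum_coe_sort (Finset.HasAntidiagonal.antidiagonal N) _)
  refine Fintype.sum_congr _ _ fun x => ?_
  show _ • ι ((A ^ (x.1.1 + x.1.2)) p) = _
  rw [Finset.HasAntidiagonal.mem_antidiagonal.1 x.2]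
  rfl

end LocalExp

/-! ### Identification of the generator and existence of the group. -/

section Generator

variable {P H : Type*} [AddCommGroup P] [Module ℂ P] [NormedAddCommGroup H]
  [InnerProductSpace ℂ H] {ι : P →ₗ[ℂ] H} {A : Module.End ℂ P}

theorem exp_mul_abs_le (M : ℝ) {s K : ℝ} (h : |s| ≤ K) :
    Real.exp (M * |s|) ≤ Real.exp (|M| * K) := by
  gcongr
  exact le_abs_self M

/-- Strong continuity with locally bounded norms gives joint continuity, which makes the integrals
of orbits continuous in the initial vector. -/
theorem continuous_uncurry_of_norm_le {U : ℝ → (H →L[ℂ] H)} {M : ℝ}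
    (hc : ∀ f, Continuous fun t => U t f)
    (hb : ∀ t f, ‖U t f‖ ≤ Real.exp (M * |t|) * ‖f‖) :
    Continuous fun x : H × ℝ => U x.2 x.1 := by
  rw [continuous_iff_continuousAt]
  rintro ⟨f, s⟩
  rw [ContinuousAt, tendsto_iff_norm_sub_tendsto_zero]
  have h1 : Continuous fun x : H × ℝ => Real.exp (M * |x.2|) * ‖x.1 - f‖ + ‖U x.2 f - U s f‖ := by
    have := (hc f).comp (continuous_snd (X := H))
    simp only [Function.comp_def] at this
    fun_prop
  refine squeeze_zero (fun _ => norm_nonneg _) (fun x => ?_) ((h1.tendsto' (f, s) 0 (by simp)))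
  have e : U x.2 x.1 - U s f = U x.2 (x.1 - f) + (U x.2 f - U s f) := by
    rw [map_sub]; abel
  rw [e]
  exact (norm_add_le _ _).trans (add_le_add_left (hb _ _) _)

theorem continuous_of_dense {U : ℝ → (H →L[ℂ] H)} {M : ℝ} (hι : DenseRange ι)
    (hc : ∀ p, Continuous fun t => U t (ι p))
    (hb : ∀ t f, ‖U t f‖ ≤ Real.exp (M * |t|) * ‖f‖) (f : H) : Continuous fun t => U t f := by
  rw [continuous_iff_continuousAt]
  intro t
  refine continuousAt_of_locally_uniform_approx_of_continuousAt fun u hu => ?_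
  obtain ⟨ε, hε, hu⟩ := Metric.mem_uniformity_dist.1 hu
  have hK := Real.exp_pos (|M| * (|t| + 1))
  obtain ⟨p, hp⟩ := hι.exists_dist_lt f (div_pos hε hK)
  refine ⟨Metric.ball t 1, Metric.ball_mem_nhds t one_pos, fun s => U s (ι p),
    (hc p).continuousAt, fun s hs => hu ?_⟩
  have hs' : |s| ≤ |t| + 1 := by
    have := abs_sub_abs_le_abs_sub s t
    rw [Metric.mem_ball, Real.dist_eq] at hs
    linarith
  rw [dist_eq_norm] at hp ⊢
  rw [← map_sub]
  calc ‖U s (f - ι p)‖ ≤ Real.exp (|M| * (|t| + 1)) * ‖f - ι p‖ :=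
        (hb _ _).trans (mul_le_mul_of_nonneg_right (exp_mul_abs_le M hs') (norm_nonneg _))
    _ < ε := by rwa [lt_div_iff₀' hK] at hp

variable [CompleteSpace H]

theorem intervalIntegral_mem_submodule {E : Type*} [NormedAddCommGroup E] [NormedSpace ℂ E]
    [CompleteSpace E] (S : Submodule ℂ E) (hS : IsClosed (S : Set E)) {c : ℝ → E}
    (hc : Continuous c) (hm : ∀ s, c s ∈ S) (a b : ℝ) : ∫ s in a..b, c s ∈ S := by
  have : CompleteSpace S := hS.completeSpace_coe
  have h : Continuous fun s => (⟨c s, hm s⟩ : S) := hc.subtype_mk hm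
  have := S.subtypeL.intervalIntegral_comp_comm (μ := MeasureTheory.volume) (h.intervalIntegrable a b)
  simp only [Submodule.subtypeL_apply] at this
  rw [this]
  exact Subtype.mem _

/-- The dense domain is a core because its orbits remain in the closure of the graph. Time averages
of orbits carry this to arbitrary initial vectors. -/
theorem isGroupWithGenerator_of_core {U : ℝ → (H →L[ℂ] H)} {M : ℝ} (hι : DenseRange ι)
    (h0 : U 0 = 1) (hadd : ∀ s t, U (s + t) = U s * U t) (hc : ∀ f, Continuous fun t => U t f)
    (hb : ∀ t f, ‖U t f‖ ≤ Real.exp (M * |t|) * ‖f‖)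
    (hd : ∀ p t, HasDerivAt (fun s => U s (ι p)) (U t (ι (A p))) t)
    (hm : ∀ p t, (U t (ι p), U t (ι (A p))) ∈ graphClosure ι A) :
    IsGroupWithGenerator (graphClosure ι A) U := by
  have hunc := continuous_uncurry_of_norm_le hc hb
  have hint : ∀ b, Continuous fun f => ∫ s in (0 : ℝ)..b, U s f := fun b =>
    intervalIntegral.continuous_parametric_intervalIntegral_of_continuous
      (f := fun f s => U s f) hunc continuous_const
  have hftc : ∀ p b, ∫ s in (0 : ℝ)..b, U s (ι (A p)) = U b (ι p) - ι p := fun p b => by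
    rw [intervalIntegral.integral_eq_sub_of_hasDerivAt (fun s _ => hd p s)
      ((hc _).intervalIntegrable _ _), h0]
    rfl
  have hderiv : ∀ f, HasDerivAt (fun b => ∫ s in (0 : ℝ)..b, U s f) f 0 := fun f => by
    have := intervalIntegral.integral_hasDerivAt_right ((hc f).intervalIntegrable 0 0)
      (hc f).stronglyMeasurable.stronglyMeasurableAtFilter (hc f).continuousAt
    simpa [h0] using this
  refine ⟨h0, hadd, hc, fun f g => ⟨fun hfg => ?_, fun hfg => ?_⟩⟩
  -- On the dense domain this pair is the integral of `(U s (ι p), U s (ι (A p)))`, which stays in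
  -- the closed subspace; density gives every `f`. Dividing by `b` and letting `b → 0` then yields
  -- `(f, g)`.
  · have hmean : ∀ b, (∫ s in (0 : ℝ)..b, U s f, U b f - f) ∈ graphClosure ι A := by
      intro b
      refine hι.induction_on (p := fun f => (∫ s in (0 : ℝ)..b, U s f, U b f - f) ∈ graphClosure ι A)
        f ?_ fun p => ?_
      · exact (isClosed_graphClosure ι A).preimage ((hint b).prodMk (by fun_prop))
      · have hcp : Continuous fun s => (U s (ι p), U s (ι (A p))) := (hc _).prodMk (hc _)
        have h1 := intervalIntegral_mem_submodule _ (isClosed_graphClosure ι A) hcp (hm p) 0 b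
        have h2 := (ContinuousLinearMap.fst ℂ H H).intervalIntegral_comp_comm (μ := MeasureTheory.volume)
          (hcp.intervalIntegrable 0 b)
        have h3 := (ContinuousLinearMap.snd ℂ H H).intervalIntegral_comp_comm (μ := MeasureTheory.volume)
          (hcp.intervalIntegrable 0 b)
        simp only [ContinuousLinearMap.coe_fst', ContinuousLinearMap.coe_snd'] at h2 h3
        rw [← hftc, h2, h3]
        exact h1
    have h1 := (hasDerivAt_iff_tendsto_slope.1 (hderiv f)).prodMk_nhds
      (hasDerivAt_iff_tendsto_slope.1 hfg)
    refine (isClosed_graphClosure ι A).mem_of_tendsto h1 (Eventually.of_forall fun b => ?_)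
    have h2 := (graphClosure ι A).smul_mem (((b - 0)⁻¹ : ℝ) : ℂ) (hmean b)
    simp only [slope_def_module, intervalIntegral.integral_same, sub_zero, h0]
    rw [sub_zero] at h2
    exact h2
  -- The integrated equation is a closed condition on `(f, g)`, unlike differentiability; it is
  -- differentiated only after passing to the closure.
  · have hint' : ∀ b, U b f = f + ∫ s in (0 : ℝ)..b, U s g := by
      intro b
      refine graphClosure_induction (Q := fun f g => U b f = f + ∫ s in (0 : ℝ)..b, U s g)
        ?_ (fun p => ?_) hfg
      · have := (hint b).comp (continuous_snd (X := H))
        simp only [Function.comp_def] at this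
        exact isClosed_eq (by fun_prop) (by fun_prop)
      · rw [hftc]; abel
    simp only [hint']
    exact (hderiv g).const_add f

/-- A quasi-skew operator with a dense domain of analytic vectors, of a common radius of
convergence, generates a strongly continuous one-parameter group. -/
theorem AnalyticVectors.exists_group {R M : ℝ} (h : AnalyticVectors ι A R) (hR : 0 < R)
    (hι : DenseRange ι) (hΓ : QuasiSkew (graphClosure ι A) M) :
    ∃ U : ℝ → (H →L[ℂ] H), IsGroupWithGenerator (graphClosure ι A) U := by
  have hV : ∀ t : ℝ, ∃ V : H →L[ℂ] H, |t| * R < 1 / 2 → ∀ p, V (ι p) = expSeries ι A t p := by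
    intro t
    by_cases ht : |t| * R < 1 / 2
    · obtain ⟨V, hV⟩ := h.exists_local hR hι hΓ ht
      exact ⟨V, fun _ => hV⟩
    -- An arbitrary value: only times within the local radius enter below.
    · exact ⟨1, fun h => absurd h ht⟩
  choose V hV using hV
  have hρ : ∀ t, |t| < 1 / 2 / R ↔ |t| * R < 1 / 2 := fun t => lt_div_iff₀ hR
  have hext : ∀ W W' : H →L[ℂ] H, (∀ p, W (ι p) = W' (ι p)) → W = W' := fun W W' hW => by
    ext f
    exact hι.induction_on (p := fun f => W f = W' f) f
      (isClosed_eq (by fun_prop) (by fun_prop)) hW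
  obtain ⟨U, hadd, hUV⟩ := exists_hom_of_local_hom (V := V) (ρ := 1 / 2 / R) (by positivity)
    (hext _ _ fun p => by rw [hV 0 (by simp), expSeries_zero]; rfl)
    (fun s t hs ht hst => hext _ _ fun p => by
      rw [hρ] at hs ht hst
      rw [mul_apply_eq_comp, hV t ht, hV _ hst,
        h.map_expSeries hR hs ht (hV s hs)])
  have hU : ∀ t, |t| * R < 1 / 2 → ∀ p, U t (ι p) = expSeries ι A t p := fun t ht => by
    rw [hUV t ((hρ t).2 ht)]; exact hV t ht
  have h0 : U 0 = 1 := hext _ _ fun p => by rw [hU 0 (by simp), expSeries_zero]; rfl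
  have hd : ∀ p t, HasDerivAt (fun s => U s (ι p)) (U t (ι (A p))) t := by
    intro p t
    have h1 : HasDerivAt (fun s => U (s - t) (ι p)) (ι (A p)) t := by
      have h2 := h.hasDerivAt hR (t := 0) (by simp) p
      rw [expSeries_zero] at h2
      have h3 : HasDerivAt (fun s => U s (ι p)) (ι (A p)) (t - t) := by
        rw [sub_self]
        refine h2.congr_of_eventuallyEq ?_
        filter_upwards [Metric.ball_mem_nhds (0 : ℝ) (ε := 1 / 2 / R) (by positivity)] with s hs
        refine hU s ?_ p
        rw [← hρ]
        simpa using hs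
      exact HasDerivAt.comp_sub_const t t h3
    have h2 := ((U t).restrictScalars ℝ).hasFDerivAt.comp_hasDerivAt t h1
    refine h2.congr_of_eventuallyEq (Eventually.of_forall fun s => ?_)
    show U s (ι p) = U t (U (s - t) (ι p))
    rw [← mul_apply_eq_comp, ← hadd, add_sub_cancel]
  -- Invariance of the closed graph is known for small times from the series; writing `U t = U (t /
  -- 2) * U (t / 2)` doubles the admissible range at each induction step.
  have hinv : ∀ (n : ℕ) (t : ℝ), |t| * R < 2 ^ n * (1 / 2) → ∀ f g,
      (f, g) ∈ graphClosure ι A → (U t f, U t g) ∈ graphClosure ι A := by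
    intro n
    induction n with
    | zero =>
      intro t ht f g hfg
      rw [pow_zero, one_mul] at ht
      refine graphClosure_induction (Q := fun f g => (U t f, U t g) ∈ graphClosure ι A)
        ?_ (fun p => ?_) hfg
      · exact (isClosed_graphClosure ι A).preimage (by fun_prop)
      · rw [hU t ht, hU t ht]
        exact h.mem_graphClosure hR (by linarith) p
    | succ n ih =>
      intro t ht f g hfg
      have h2 : |t / 2| * R < 2 ^ n * (1 / 2) := by
        rw [abs_div, abs_two]
        rw [pow_succ] at ht
        linarith
      have h3 := ih _ h2 _ _ (ih _ h2 _ _ hfg)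
      rwa [← mul_apply_eq_comp, ← mul_apply_eq_comp, ← hadd, add_halves] at h3
  have hm : ∀ p t, (U t (ι p), U t (ι (A p))) ∈ graphClosure ι A := by
    intro p t
    obtain ⟨n, hn⟩ := pow_unbounded_of_one_lt (2 * (|t| * R)) one_lt_two
    exact hinv n t (by linarith) _ _ (_root_.mem_graphClosure ι A p)
  have hb : ∀ t f, ‖U t f‖ ≤ Real.exp (M * |t|) * ‖f‖ := by
    intro t f
    refine hι.induction_on (p := fun f => ‖U t f‖ ≤ Real.exp (M * |t|) * ‖f‖) f
      (isClosed_le (by fun_prop) (by fun_prop)) fun p => ?_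
    have := hΓ.norm_le (u := fun s => U s (ι p)) (v := fun s => U s (ι (A p))) t
      (fun s _ => hd p s) (fun s _ => hm p s)
    simpa [h0] using this
  exact ⟨U, isGroupWithGenerator_of_core hι h0 hadd
    (continuous_of_dense hι (fun p => continuous_iff_continuousAt.2 fun t => (hd p t).continuousAt)
      hb) hb hd hm⟩

end Generator

/-! ### The weighted shift on a single copy of `ℂ[z]`. -/

section Sector

open Polynomial (monomial)
open FockD21 (shiftEuler pair)

/-- The operator `z - (c + z d/dz) d/dz` on polynomials. -/
noncomputable def sectorOp (c : ℝ) : Module.End ℂ (Polynomial ℂ) where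
  toFun f := Polynomial.X * f - shiftEuler c (Polynomial.derivative f)
  map_add' f g := by simp [shiftEuler]; ring
  map_smul' a f := by simp [shiftEuler, smul_sub, smul_comm a]

theorem sectorOp_apply (c : ℝ) (f : Polynomial ℂ) :
    sectorOp c f = Polynomial.X * f - shiftEuler c (Polynomial.derivative f) := rfl

theorem coeff_sectorOp_zero (c : ℝ) (f : Polynomial ℂ) :
    (sectorOp c f).coeff 0 = -((c * 1 : ℝ) * f.coeff 1) := by
  rw [sectorOp_apply, Polynomial.coeff_sub, FockD21.coeff_shiftEuler_derivative]
  simp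

theorem coeff_sectorOp_succ (c : ℝ) (f : Polynomial ℂ) (k : ℕ) :
    (sectorOp c f).coeff (k + 1)
      = f.coeff k - (((c + (k + 1 : ℕ)) * (k + 2) : ℝ) : ℂ) * f.coeff (k + 2) := by
  rw [sectorOp_apply, Polynomial.coeff_sub, FockD21.coeff_shiftEuler_derivative,
    Polynomial.coeff_X_mul]
  push_cast
  ring

theorem sectorOp_monomial_zero (c : ℝ) : sectorOp c (monomial 0 1) = monomial 1 1 := by
  ext k
  rcases k with _ | k
  · rw [coeff_sectorOp_zero]; simp only [Polynomial.coeff_monomial]; simp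
  · rw [coeff_sectorOp_succ]; simp only [Polynomial.coeff_monomial]; simp [eq_comm]

theorem sectorOp_monomial_succ (c : ℝ) (j : ℕ) : sectorOp c (monomial (j + 1) 1)
    = monomial (j + 2) 1 - (((c + j) * (j + 1) : ℝ) : ℂ) • monomial j 1 := by
  ext k
  rcases k with _ | k
  · rw [coeff_sectorOp_zero]
    simp only [Polynomial.coeff_sub, Polynomial.coeff_smul, Polynomial.coeff_monomial]
    rcases j with _ | j <;> simp
  · rw [coeff_sectorOp_succ]
    simp only [Polynomial.coeff_sub, Polynomial.coeff_smul, Polynomial.coeff_monomial]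
    by_cases h : j = k + 1
    · subst h
      simp [add_assoc, one_add_one_eq_two]
    · simp [h]

/-- Squared norms `w k` of monomials `z ^ k` for which `d/dz (c + z d/dz)` is, up to signs, adjoint
to multiplication by `z`. -/
structure IsSectorWeight (c : ℝ) (w : ℕ → ℝ) : Prop where
  pos : ∀ k, 0 < w k
  succ : ∀ k, w (k + 1) = |(c + k) * (k + 1)| * w k

namespace IsSectorWeight

variable {c : ℝ} {w : ℕ → ℝ}

theorem defect_eq_zero (hw : IsSectorWeight c w) (hc : 0 < c) (k : ℕ) :
    w (k + 1) - (c + k) * (k + 1) * w k = 0 := by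
  rw [hw.succ, abs_of_pos (by positivity), sub_self]

/-- The defect vanishes if `c + k ≥ 0`. Otherwise it equals `2 * w (k + 1)`, but then `k < |c|`, so
the ratio of consecutive weights is at most `B ^ 2`. Control by both weights is needed in
`abs_re_pair_le`. -/
theorem abs_defect_le (hw : IsSectorWeight c w) {B : ℝ} (hB : |c| + 1 ≤ B) (k : ℕ) :
    |w (k + 1) - (c + k) * (k + 1) * w k| ≤ 2 * B ^ 2 * w k ∧
      |w (k + 1) - (c + k) * (k + 1) * w k| ≤ 2 * B ^ 2 * w (k + 1) := by
  have h0 := hw.pos k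
  have h1 := hw.pos (k + 1)
  have hc := abs_nonneg c
  rcases le_or_gt 0 (c + k) with h | h
  · rw [hw.succ, abs_of_nonneg (a := (c + k) * (k + 1)) (by positivity), sub_self, abs_zero]
    constructor <;> positivity
  · have hk : (0 : ℝ) ≤ k := by positivity
    have e : |(c + k) * (k + 1)| = -((c + k) * (k + 1)) := abs_of_neg (by nlinarith)
    have e' : w (k + 1) - (c + k) * (k + 1) * w k = 2 * w (k + 1) := by
      rw [hw.succ, e]; ring
    have hkc : (k : ℝ) < |c| := by linarith [neg_le_abs c]
    rw [e', abs_of_pos (by positivity)]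
    have hB2 : 1 ≤ B ^ 2 := one_le_pow₀ (by linarith)
    refine ⟨?_, by nlinarith⟩
    have : |(c + k) * (k + 1)| ≤ B ^ 2 := by
      rw [e]
      have : -(c + k) ≤ B := by linarith [neg_le_abs c]
      have h2 : (k : ℝ) + 1 ≤ B := by linarith
      nlinarith
    rw [hw.succ, mul_assoc]
    gcongr

theorem abs_add_mul_le {B : ℝ} (hB : |c| + 1 ≤ B) (k : ℕ) :
    |(c + k) * (k + 1)| ≤ (B * (k + 1)) ^ 2 := by
  have hc := abs_nonneg c
  have hk : (0 : ℝ) ≤ k := by positivity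
  rw [abs_mul, abs_of_nonneg (a := (k + 1 : ℝ)) (by positivity), mul_pow, pow_two (k + 1 : ℝ),
    ← mul_assoc]
  gcongr
  calc |c + k| ≤ |c| + k := (abs_add_le _ _).trans (by rw [Nat.abs_cast])
    _ ≤ (|c| + 1) ^ 2 * (k + 1) := by nlinarith [mul_nonneg hc hk, mul_nonneg (mul_nonneg hc hc) hk]
    _ ≤ B ^ 2 * (k + 1) := by gcongr

/-- Summation by parts: raising and lowering contribute the same products of adjacent coefficients,
up to sign and weight. The boundary term makes the induction work, and it disappears once `N`
reaches the degree. -/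
theorem sum_re_sectorOp_eq (w : ℕ → ℝ) (c : ℝ) (f : Polynomial ℂ) (N : ℕ) :
    ∑ k ∈ Finset.range (N + 1), w k * (f.coeff k * starRingEnd ℂ ((sectorOp c f).coeff k)).re
      = ∑ k ∈ Finset.range (N + 1), (w (k + 1) - (c + k) * (k + 1) * w k) *
          (f.coeff k * starRingEnd ℂ (f.coeff (k + 1))).re
        - w (N + 1) * (f.coeff N * starRingEnd ℂ (f.coeff (N + 1))).re := by
  induction N with
  | zero =>
    simp only [zero_add, Finset.sum_range_one, coeff_sectorOp_zero, Complex.neg_re, Complex.mul_re,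
      Complex.mul_im, Complex.conj_re, Complex.conj_im, Complex.ofReal_re, Complex.ofReal_im, Complex.neg_im, Nat.cast_zero]
    ring
  | succ N ih =>
    rw [Finset.sum_range_succ, ih, Finset.sum_range_succ _ (N + 1), coeff_sectorOp_succ]
    simp only [map_sub, map_mul,
      Complex.conj_ofReal, Complex.sub_re, Complex.sub_im, Complex.mul_re, Complex.mul_im,
      Complex.conj_re, Complex.conj_im, Complex.ofReal_re, Complex.ofReal_im]
    push_cast
    ring

theorem abs_re_pair_le (hw : IsSectorWeight c w) {M : ℝ}
    (hM : ∀ k, |w (k + 1) - (c + k) * (k + 1) * w k| ≤ M * w k ∧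
      |w (k + 1) - (c + k) * (k + 1) * w k| ≤ M * w (k + 1)) (f : Polynomial ℂ) :
    |(pair w f ((sectorOp c f).map (starRingEnd ℂ))).re|
      ≤ M * (pair w f (f.map (starRingEnd ℂ))).re := by
  set N := f.natDegree
  have hN : f.coeff (N + 1) = 0 := Polynomial.coeff_eq_zero_of_natDegree_lt (Nat.lt_succ_self _)
  have h1 : (pair w f ((sectorOp c f).map (starRingEnd ℂ))).re
      = ∑ k ∈ Finset.range (N + 1), (w (k + 1) - (c + k) * (k + 1) * w k) *
          (f.coeff k * starRingEnd ℂ (f.coeff (k + 1))).re := by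
    have h := sum_re_sectorOp_eq w c f N
    rw [hN, map_zero, mul_zero, Complex.zero_re, mul_zero, sub_zero] at h
    rw [← h, FockD21.pair_eq w f _ (N + 1) (Nat.lt_succ_self _), Complex.re_sum]
    refine Finset.sum_congr rfl fun k _ => ?_
    rw [Polynomial.coeff_map, mul_comm (f.coeff k), mul_assoc, Complex.re_ofReal_mul]
  -- By `2 a b ≤ a² + b²` each product is split between its two coefficients, and the defect is
  -- charged to the weight belonging to each.
  have h2 : ∀ k, |(w (k + 1) - (c + k) * (k + 1) * w k) *
      (f.coeff k * starRingEnd ℂ (f.coeff (k + 1))).re|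
      ≤ M / 2 * (w k * ‖f.coeff k‖ ^ 2) + M / 2 * (w (k + 1) * ‖f.coeff (k + 1)‖ ^ 2) := by
    intro k
    obtain ⟨ha, hb⟩ := hM k
    have hr : |(f.coeff k * starRingEnd ℂ (f.coeff (k + 1))).re|
        ≤ (‖f.coeff k‖ ^ 2 + ‖f.coeff (k + 1)‖ ^ 2) / 2 := by
      refine (Complex.abs_re_le_norm _).trans ?_
      rw [norm_mul, Complex.norm_conj]
      nlinarith [sq_nonneg (‖f.coeff k‖ - ‖f.coeff (k + 1)‖)]
    rw [abs_mul]
    refine (mul_le_mul_of_nonneg_left hr (abs_nonneg _)).trans ?_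
    have p1 := mul_le_mul_of_nonneg_right ha (sq_nonneg ‖f.coeff k‖)
    have p2 := mul_le_mul_of_nonneg_right hb (sq_nonneg ‖f.coeff (k + 1)‖)
    linarith
  have hM0 : 0 ≤ M := by
    have := (abs_nonneg _).trans (hM 0).1
    exact nonneg_of_mul_nonneg_left this (hw.pos 0)
  have h3 : (pair w f (f.map (starRingEnd ℂ))).re
      = ∑ k ∈ Finset.range (N + 1), w k * ‖f.coeff k‖ ^ 2 := by
    rw [FockD21.pair_self, Complex.ofReal_re]
  have h4 : ∑ k ∈ Finset.range (N + 1), w (k + 1) * ‖f.coeff (k + 1)‖ ^ 2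
      ≤ ∑ k ∈ Finset.range (N + 1), w k * ‖f.coeff k‖ ^ 2 := by
    have := Finset.sum_range_succ' (fun k => w k * ‖f.coeff k‖ ^ 2) (N + 1)
    rw [Finset.sum_range_succ, hN] at this
    have h0 := hw.pos 0
    have : 0 ≤ w 0 * ‖f.coeff 0‖ ^ 2 := by positivity
    simp at *
    linarith
  rw [h1, h3]
  refine (Finset.abs_sum_le_sum_abs _ _).trans ((Finset.sum_le_sum fun k _ => h2 k).trans ?_)
  rw [Finset.sum_add_distrib, ← Finset.mul_sum, ← Finset.mul_sum]
  nlinarith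

variable {V : Type*} [NormedAddCommGroup V] [NormedSpace ℂ V]

/-- Each application moves a monomial up or down by one degree. By the weight recursion a step from
degree `k` costs at most `B (k + 1)` in either direction. With two choices per step and degrees
rising by at most one, `n` steps cost at most `(2 B) ^ n (k + 1) ⋯ (k + n)`. -/
theorem norm_sectorOp_pow_monomial_le (hw : IsSectorWeight c w) {B : ℝ} (hB : |c| + 1 ≤ B)
    {E : Polynomial ℂ →ₗ[ℂ] V} (hE : ∀ k, ‖E (monomial k 1)‖ ^ 2 = w k) (n k : ℕ) :
    ‖E ((sectorOp c ^ n) (monomial k 1))‖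
      ≤ (2 * B) ^ n * (k + 1).ascFactorial n * ‖E (monomial k 1)‖ := by
  have hB0 : 0 < B := by linarith [abs_nonneg c]
  have hup : ∀ k : ℕ, ‖E (monomial (k + 1) 1)‖ ≤ B * (k + 1) * ‖E (monomial k 1)‖ := by
    intro k
    refine abs_le_of_sq_le_sq' ?_ (by positivity) |>.2
    rw [mul_pow, hE, hE, hw.succ]
    exact mul_le_mul_of_nonneg_right (abs_add_mul_le hB k) (hw.pos k).le
  have hdown : ∀ k : ℕ, |(c + k) * (k + 1)| * ‖E (monomial k 1)‖
      ≤ B * (k + 1) * ‖E (monomial (k + 1) 1)‖ := by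
    intro k
    refine abs_le_of_sq_le_sq' ?_ (by positivity) |>.2
    rw [mul_pow, mul_pow, hE, hE, hw.succ, pow_two |_|, mul_assoc]
    exact mul_le_mul_of_nonneg_right (abs_add_mul_le hB k)
      (mul_nonneg (abs_nonneg _) (hw.pos k).le)
  have hasc : ∀ m n : ℕ, (m + 1).ascFactorial (n + 1) = (m + 1) * (m + 2).ascFactorial n :=
    fun m n => by rw [Nat.succ_ascFactorial, Nat.ascFactorial_succ]
  induction n generalizing k with
  | zero => simp
  | succ n ih =>
    rw [pow_succ, Module.End.mul_apply]
    rcases k with _ | k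
    · rw [sectorOp_monomial_zero]
      refine (ih 1).trans ?_
      have h1 := hup 0
      rw [hasc]
      push_cast at h1 ⊢
      simp only [zero_add, mul_one, one_mul] at h1 ⊢
      calc (2 * B) ^ n * ((1 + 1).ascFactorial n : ℝ) * ‖E (monomial 1 1)‖
          ≤ (2 * B) ^ n * ((1 + 1).ascFactorial n : ℝ) * (2 * (B * ‖E (monomial 0 1)‖)) := by
            gcongr
            nlinarith [norm_nonneg (E (monomial 1 1))]
        _ = _ := by norm_num; ring
    · rw [sectorOp_monomial_succ, map_sub, map_sub, map_smul, map_smul]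
      have h1 := hup (k + 1)
      have h2 := hdown k
      -- The downward branch is dominated by the upward one; their sum accounts for the factor `2`.
      have h3 : ((k + 1) * (k + 1).ascFactorial n : ℝ) ≤ (k + 2) * (k + 3).ascFactorial n := by
        have := Nat.ascFactorial_le n (show k + 1 ≤ k + 3 by omega)
        gcongr
        norm_num
      refine (norm_sub_le _ _).trans ?_
      rw [norm_smul, Complex.norm_real, Real.norm_eq_abs, hasc]
      push_cast at h1 ⊢
      set x := ‖E (monomial (k + 1) 1)‖
      calc ‖E ((sectorOp c ^ n) (monomial (k + 2) 1))‖
            + |(c + k) * (k + 1)| * ‖E ((sectorOp c ^ n) (monomial k 1))‖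
          ≤ (2 * B) ^ n * (k + 3).ascFactorial n * ‖E (monomial (k + 2) 1)‖
            + |(c + k) * (k + 1)| * ((2 * B) ^ n * (k + 1).ascFactorial n * ‖E (monomial k 1)‖) := by
            gcongr
            · exact ih (k + 2)
            · exact ih k
        _ = (2 * B) ^ n * (k + 3).ascFactorial n * ‖E (monomial (k + 2) 1)‖
            + (2 * B) ^ n * (k + 1).ascFactorial n *
              (|(c + k) * (k + 1)| * ‖E (monomial k 1)‖) := by ring
        _ ≤ (2 * B) ^ n * (k + 3).ascFactorial n * (B * (k + 1 + 1) * x)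
            + (2 * B) ^ n * (k + 1).ascFactorial n * (B * (k + 1) * x) := by gcongr
        _ = (2 * B) ^ n * B * x * ((k + 2) * (k + 3).ascFactorial n)
            + (2 * B) ^ n * B * x * ((k + 1) * (k + 1).ascFactorial n) := by ring
        _ ≤ (2 * B) ^ n * B * x * ((k + 2) * (k + 3).ascFactorial n)
            + (2 * B) ^ n * B * x * ((k + 2) * (k + 3).ascFactorial n) := by gcongr
        _ = _ := by ring

/-- Here `(k + 1) ⋯ (k + n) = n! * (k + n).choose n ≤ n! 2 ^ k 2 ^ n`: the degree enters only the
constant, so the radius is common to all polynomials. -/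
theorem exists_norm_sectorOp_pow_le (hw : IsSectorWeight c w) {B : ℝ} (hB : |c| + 1 ≤ B)
    {E : Polynomial ℂ →ₗ[ℂ] V} (hE : ∀ k, ‖E (monomial k 1)‖ ^ 2 = w k) (f : Polynomial ℂ) :
    ∃ C, ∀ n : ℕ, ‖E ((sectorOp c ^ n) f)‖ ≤ C * n.factorial * (4 * B) ^ n := by
  have hB0 : 0 < B := by linarith [abs_nonneg c]
  induction f using Polynomial.induction_on' with
  | add p q hp hq =>
    obtain ⟨C, hC⟩ := hp
    obtain ⟨D, hD⟩ := hq
    refine ⟨C + D, fun n => ?_⟩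
    rw [map_add, map_add]
    refine (norm_add_le _ _).trans ((add_le_add (hC n) (hD n)).trans_eq ?_)
    ring
  | monomial k a =>
    refine ⟨‖a‖ * 2 ^ k * ‖E (monomial k 1)‖, fun n => ?_⟩
    have e : monomial k a = a • monomial k 1 := by simp [Polynomial.smul_monomial]
    have h1 : ((k + 1).ascFactorial n : ℝ) ≤ n.factorial * (2 ^ k * 2 ^ n) := by
      rw [Nat.ascFactorial_eq_factorial_mul_choose, ← pow_add]
      exact_mod_cast Nat.mul_le_mul_left _ (Nat.choose_le_two_pow _ _)
    rw [e, map_smul, map_smul, norm_smul]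
    calc ‖a‖ * ‖E ((sectorOp c ^ n) (monomial k 1))‖
        ≤ ‖a‖ * ((2 * B) ^ n * (n.factorial * (2 ^ k * 2 ^ n)) * ‖E (monomial k 1)‖) := by
          gcongr
          refine (hw.norm_sectorOp_pow_monomial_le hB hE n k).trans ?_
          gcongr
      _ = _ := by
          rw [show (4 : ℝ) * B = 2 * B * 2 by ring, mul_pow (2 * B)]; ring

end IsSectorWeight

end Sector

/-! ### The four sectors of the Fock space; existence and uniqueness of the group. -/

namespace FockD21

open UniformSpace

variable (α : ℝ)

theorem re_pair_monomial (w : ℕ → ℝ) (k : ℕ) :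
    (pair w (Polynomial.monomial k 1) ((Polynomial.monomial k 1).map (starRingEnd ℂ))).re = w k := by
  rw [pair_monomial]; simp

/-- The normal form decouples the operator. On the odd sectors `z₃ ∂₃ + z₄ ∂₄` acts as `1`, which
shifts the parameter from `-α` to `1 - α`. -/
theorem nfEquiv_dρH₂ (x : PolyFock α) : nfEquiv α (dρH₂ α x) =
    (sectorOp (-α) (nfEquiv α x).1, sectorOp (-α) (nfEquiv α x).2.1,
      sectorOp (1 - α) (nfEquiv α x).2.2.1, sectorOp (1 - α) (nfEquiv α x).2.2.2) := by
  obtain ⟨p, rfl⟩ := Submodule.mkQ_surjective fockIdeal x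
  have h1 := nf_z₁_pow_mul 1 p
  rw [pow_one, pow_one] at h1
  show nf (z₁ * p - bessel₁ α p) = _
  rw [map_sub, nf_bessel₁, h1]
  simp only [sectorOp_apply, Complex.ofReal_neg, Complex.ofReal_sub, Complex.ofReal_one]
  rfl

theorem mul_sign_eq_abs (x : ℝ) : x * Real.sign x = |x| := by
  rcases lt_trichotomy x 0 with h | h | h
  · rw [Real.sign_of_neg h, abs_of_neg h]; ring
  · simp [h]
  · rw [Real.sign_of_pos h, abs_of_pos h]; ring

/-- The squared norms of `z₁ ^ k` and of `z₁ ^ k z₂`. -/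
noncomputable def evenWeight (k : ℕ) : ℝ := wt α k * sgn α k

/-- The squared norms of `z₁ ^ k z₃` and of `z₁ ^ k z₄`. -/
noncomputable def oddWeight (k : ℕ) : ℝ := wtOdd α k * sgn α (k + 1)

theorem evenWeight_eq (k : ℕ) : evenWeight α k = |wt α k| := by
  rw [evenWeight, wt, sgn, mul_assoc, mul_sign_eq_abs, abs_mul, Nat.abs_cast]

theorem oddWeight_eq (k : ℕ) : oddWeight α k = |wtOdd α k| := by
  rw [oddWeight, wtOdd, sgn, mul_assoc, mul_assoc, mul_sign_eq_abs, abs_mul, abs_mul, abs_two,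
    Nat.abs_cast]

theorem ipS_eq_weight (x y : PolyFock α) : ipS α x y =
    pair (evenWeight α) (nfEquiv α x).1 ((nfEquiv α y).1.map (starRingEnd ℂ))
    + pair (evenWeight α) (nfEquiv α x).2.1 ((nfEquiv α y).2.1.map (starRingEnd ℂ))
    + pair (oddWeight α) (nfEquiv α x).2.2.1 ((nfEquiv α y).2.2.1.map (starRingEnd ℂ))
    + pair (oddWeight α) (nfEquiv α x).2.2.2 ((nfEquiv α y).2.2.2.map (starRingEnd ℂ)) :=
  ipS_eq α x y

theorem wtOdd_succ (k : ℕ) : wtOdd α (k + 1) = (1 - α + k) * (k + 1) * wtOdd α k := by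
  rw [wtOdd_eq, wtOdd_eq, wt_succ]
  push_cast
  ring

variable [Fact (∀ n : ℕ, α ≠ n)]

theorem isSectorWeight_evenWeight : IsSectorWeight (-α) (evenWeight α) where
  pos := wt_sgn_pos α
  succ k := by
    rw [evenWeight_eq, evenWeight_eq, wt_succ, ← abs_mul]
    congr 1
    ring

theorem isSectorWeight_oddWeight : IsSectorWeight (1 - α) (oddWeight α) where
  pos := wtOdd_sgn_pos α
  succ k := by rw [oddWeight_eq, oddWeight_eq, wtOdd_succ, abs_mul]

/-- The embedding of the polynomial Fock space in the Fock space. -/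
noncomputable def toFock : PolyFock α →ₗ[ℂ] Fock α :=
  (Completion.toComplₗᵢ (𝕜 := ℂ) (E := PolyFock α)).toLinearMap

theorem denseRange_toFock : DenseRange (toFock α) := Completion.denseRange_coe

theorem inner_toFock (x y : PolyFock α) : inner ℂ (toFock α x) (toFock α y) = ipS α y x :=
  Completion.inner_coe x y

theorem norm_sq_toFock (x : PolyFock α) : ‖toFock α x‖ ^ 2 = (ipS α x x).re := by
  rw [← inner_toFock]
  exact (inner_self_eq_norm_sq (𝕜 := ℂ) _).symm

/-- The infinitesimal generator, the closure of `dρ(H₂)`. -/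
noncomputable abbrev fockGenerator : Submodule ℂ (Fock α × Fock α) :=
  graphClosure (toFock α) (dρH₂ α)

theorem quasiSkew_of_defect {M : ℝ}
    (h : ∀ k, |evenWeight α (k + 1) - (-α + k) * (k + 1) * evenWeight α k| ≤ M * evenWeight α k ∧
      |evenWeight α (k + 1) - (-α + k) * (k + 1) * evenWeight α k| ≤ M * evenWeight α (k + 1))
    (h' : ∀ k, |oddWeight α (k + 1) - (1 - α + k) * (k + 1) * oddWeight α k| ≤ M * oddWeight α k ∧
      |oddWeight α (k + 1) - (1 - α + k) * (k + 1) * oddWeight α k| ≤ M * oddWeight α (k + 1)) :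
    QuasiSkew (fockGenerator α) M := by
  refine quasiSkew_graphClosure fun x => ?_
  rw [inner_toFock, norm_sq_toFock, ipS_eq_weight, ipS_eq_weight, nfEquiv_dρH₂]
  have e := (isSectorWeight_evenWeight α).abs_re_pair_le h
  have o := (isSectorWeight_oddWeight α).abs_re_pair_le h'
  simp only [Complex.add_re]
  refine (abs_add_le _ _).trans ((add_le_add ((abs_add_le _ _).trans (add_le_add
    ((abs_add_le _ _).trans (add_le_add (e _) (e _))) (o _))) (o _)).trans_eq ?_)
  ring

/-- The constant `|α| + 2` bounds `|c| + 1` for both `c = -α` and `c = 1 - α`. -/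
theorem quasiSkew_fockGenerator : QuasiSkew (fockGenerator α) (2 * (|α| + 2) ^ 2) := by
  refine quasiSkew_of_defect α
    (fun k => (isSectorWeight_evenWeight α).abs_defect_le ?_ k)
    (fun k => (isSectorWeight_oddWeight α).abs_defect_le ?_ k)
  · rw [abs_neg]; linarith
  · have := abs_sub 1 α
    rw [abs_one] at this
    linarith

theorem quasiSkew_zero_fockGenerator (hα : α < 0) : QuasiSkew (fockGenerator α) 0 := by
  refine quasiSkew_of_defect α (fun k => ?_) (fun k => ?_)
  · rw [(isSectorWeight_evenWeight α).defect_eq_zero (by linarith)]; simp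
  · rw [(isSectorWeight_oddWeight α).defect_eq_zero (by linarith)]; simp

/-- Here `E` embeds one sector; it intertwines the operators and turns the estimate for `ℂ[z]` into
one in the Fock space. -/
theorem exists_norm_dρH₂_pow_le {c : ℝ} {w : ℕ → ℝ} (hw : IsSectorWeight c w)
    (hc : |c| + 1 ≤ |α| + 2) {E : Polynomial ℂ →ₗ[ℂ] PolyFock α}
    (hA : ∀ f, dρH₂ α (E f) = E (sectorOp c f))
    (hE : ∀ k, (ipS α (E (Polynomial.monomial k 1)) (E (Polynomial.monomial k 1))).re = w k)
    (f : Polynomial ℂ) :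
    ∃ C, ∀ n : ℕ, ‖toFock α ((dρH₂ α ^ n) (E f))‖ ≤ C * n.factorial * (4 * (|α| + 2)) ^ n := by
  have hpow : ∀ n, (dρH₂ α ^ n) (E f) = E ((sectorOp c ^ n) f) := by
    intro n
    induction n with
    | zero => rfl
    | succ n ih => rw [pow_succ', Module.End.mul_apply, ih, hA, pow_succ', Module.End.mul_apply]
  simp only [hpow]
  exact hw.exists_norm_sectorOp_pow_le hc (E := toFock α ∘ₗ E)
    (fun k => (norm_sq_toFock α _).trans (hE k)) f

theorem analyticVectors_fock : AnalyticVectors (toFock α) (dρH₂ α) (4 * (|α| + 2)) := by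
  have hce : |-α| + 1 ≤ |α| + 2 := by rw [abs_neg]; linarith
  have hco : |1 - α| + 1 ≤ |α| + 2 := by
    have := abs_sub 1 α
    rw [abs_one] at this
    linarith
  intro x
  obtain ⟨⟨f₁, f₂, f₃, f₄⟩, rfl⟩ := (nfEquiv α).symm.surjective x
  have hA : ∀ f : NF, dρH₂ α ((nfEquiv α).symm f) = (nfEquiv α).symm
      (sectorOp (-α) f.1, sectorOp (-α) f.2.1, sectorOp (1 - α) f.2.2.1, sectorOp (1 - α) f.2.2.2) :=
    fun f => by
      apply (nfEquiv α).injective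
      rw [nfEquiv_dρH₂, LinearEquiv.apply_symm_apply, LinearEquiv.apply_symm_apply]
  obtain ⟨C₁, h₁⟩ := exists_norm_dρH₂_pow_le α (isSectorWeight_evenWeight α) hce
    (E := (nfEquiv α).symm.toLinearMap ∘ₗ LinearMap.inl ℂ _ _) (fun f => by simp [hA])
    (fun k => by simp [ipS_eq_weight, re_pair_monomial, -Polynomial.map_monomial,
      pair_zero_right]) f₁
  obtain ⟨C₂, h₂⟩ := exists_norm_dρH₂_pow_le α (isSectorWeight_evenWeight α) hce
    (E := (nfEquiv α).symm.toLinearMap ∘ₗ LinearMap.inr ℂ _ _ ∘ₗ LinearMap.inl ℂ _ _)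
    (fun f => by simp [hA])
    (fun k => by simp [ipS_eq_weight, re_pair_monomial, -Polynomial.map_monomial,
      pair_zero_right]) f₂
  obtain ⟨C₃, h₃⟩ := exists_norm_dρH₂_pow_le α (isSectorWeight_oddWeight α) hco
    (E := (nfEquiv α).symm.toLinearMap ∘ₗ LinearMap.inr ℂ _ _ ∘ₗ LinearMap.inr ℂ _ _ ∘ₗ
      LinearMap.inl ℂ _ _) (fun f => by simp [hA])
    (fun k => by simp [ipS_eq_weight, re_pair_monomial, -Polynomial.map_monomial,
      pair_zero_right]) f₃
  obtain ⟨C₄, h₄⟩ := exists_norm_dρH₂_pow_le α (isSectorWeight_oddWeight α) hco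
    (E := (nfEquiv α).symm.toLinearMap ∘ₗ LinearMap.inr ℂ _ _ ∘ₗ LinearMap.inr ℂ _ _ ∘ₗ
      LinearMap.inr ℂ _ _) (fun f => by simp [hA])
    (fun k => by simp [ipS_eq_weight, re_pair_monomial, -Polynomial.map_monomial,
      pair_zero_right]) f₄
  refine ⟨C₁ + C₂ + C₃ + C₄, fun n => ?_⟩
  have e : ((f₁, f₂, f₃, f₄) : NF) = (f₁, 0, 0, 0) + (0, f₂, 0, 0) + (0, 0, f₃, 0) + (0, 0, 0, f₄) := by
    simp
  rw [e]
  simp only [map_add]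
  refine (norm_add_le _ _).trans ((add_le_add ((norm_add_le _ _).trans (add_le_add
    ((norm_add_le _ _).trans (add_le_add (h₁ n) (h₂ n))) (h₃ n))) (h₄ n)).trans_eq ?_)
  ring

theorem isExpGroup_iff {U : ℝ → (Fock α →L[ℂ] Fock α)} :
    IsExpGroup α U ↔ IsGroupWithGenerator (fockGenerator α) U :=
  ⟨fun h => ⟨h.map_zero, h.map_add, h.continuous, h.generator⟩,
    fun h => ⟨h.map_zero, h.map_add, h.continuous, h.generator⟩⟩

theorem existsUnique_isExpGroup : ∃! U : ℝ → (Fock α →L[ℂ] Fock α), IsExpGroup α U := by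
  simp only [isExpGroup_iff]
  obtain ⟨U, hU⟩ := (analyticVectors_fock α).exists_group (by positivity) (denseRange_toFock α)
    (quasiSkew_fockGenerator α)
  exact ⟨U, hU, fun U' hU' => hU'.unique hU (quasiSkew_fockGenerator α)
    (dense_domain (denseRange_toFock α))⟩

end FockD21

/-! ### The sign of `α`, unitarity and the Bessel-Fischer product. -/

namespace FockD21

open UniformSpace

variable (α : ℝ)

theorem evenWeight_eq_of_neg (hα : α < 0) : evenWeight α = wt α := by
  funext k
  rw [evenWeight_eq, abs_of_pos]
  exact mul_pos (by positivity) (ascPochhammer_pos k _ (by linarith))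

theorem oddWeight_eq_of_neg (hα : α < 0) : oddWeight α = wtOdd α := by
  funext k
  rw [oddWeight_eq, abs_of_pos]
  exact mul_pos two_pos (mul_pos (by positivity) (ascPochhammer_pos (k + 1) _ (by linarith)))

/-- The inverse of the fundamental symmetry for `α < 0`, in normal form. -/
noncomputable def symmInvNF : NF →ₗ[ℂ] NF where
  toFun f := (f.1, -f.2.1, f.2.2.2, -f.2.2.1)
  map_add' f g := by simp; ring_nf; simp
  map_smul' a f := by simp

/-- The inverse of the fundamental symmetry for `α < 0`. -/
noncomputable def symmInv : Module.End ℂ (PolyFock α) :=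
  (nfEquiv α).symm.toLinearMap ∘ₗ symmInvNF ∘ₗ (nfEquiv α).toLinearMap

theorem nfEquiv_symmInv (x : PolyFock α) : nfEquiv α (symmInv α x) = ((nfEquiv α x).1,
    -(nfEquiv α x).2.1, (nfEquiv α x).2.2.2, -(nfEquiv α x).2.2.1) :=
  (nfEquiv α).apply_symm_apply _

/-- Only signs and an exchange of the two odd sectors are involved, and these two share the
parameter `1 - α`. -/
theorem symmInv_dρH₂ (x : PolyFock α) : symmInv α (dρH₂ α x) = dρH₂ α (symmInv α x) := by
  apply (nfEquiv α).injective
  simp [nfEquiv_symmInv, nfEquiv_dρH₂]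

theorem bf_eq_ipS_symmInv (hα : α < 0) (x y : PolyFock α) : bf α x y = ipS α x (symmInv α y) := by
  rw [ipS_eq_weight, nfEquiv_symmInv, bf_eq, evenWeight_eq_of_neg α hα, oddWeight_eq_of_neg α hα]
  simp only [pair_map_neg, bfNF, conjNF]
  ring

theorem ipS_symmInv (x y : PolyFock α) : ipS α (symmInv α x) (symmInv α y) = ipS α x y := by
  simp only [ipS_eq_weight, nfEquiv_symmInv, pair_map_neg, pair_neg_left]
  ring

variable [hα : Fact (∀ n : ℕ, α ≠ n)]

/-- Skewness is tested on `1` and `z₁`. Since `dρ(H₂) 1 = z₁` and `dρ(H₂) z₁ = z₁² + α`, the two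
inner products are `‖z₁‖² = |α| ‖1‖²` and `α ‖1‖²`, whose sum must vanish. -/
theorem neg_of_mem_unitary {U : ℝ → (Fock α →L[ℂ] Fock α)}
    (h : IsGroupWithGenerator (fockGenerator α) U)
    (hU : ∀ a, U a ∈ unitary (Fock α →L[ℂ] Fock α)) : α < 0 := by
  set x₀ : PolyFock α := (nfEquiv α).symm (Polynomial.monomial 0 1, 0, 0, 0) with h₀
  set x₁ : PolyFock α := (nfEquiv α).symm (Polynomial.monomial 1 1, 0, 0, 0) with h₁
  have key := h.inner_add_inner_eq_zero hU (mem_graphClosure _ _ x₀) (mem_graphClosure _ _ x₁)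
  have e₁ : sectorOp (-α) (Polynomial.monomial 1 1)
      = Polynomial.monomial 2 1 - ((-α : ℝ) : ℂ) • Polynomial.monomial 0 1 := by
    have := sectorOp_monomial_succ (-α) 0
    simpa using this
  have i₁ : ipS α (dρH₂ α x₁) x₀ = ((α * evenWeight α 0 : ℝ) : ℂ) := by
    rw [ipS_eq_weight, nfEquiv_dρH₂, h₀, h₁, LinearEquiv.apply_symm_apply,
      LinearEquiv.apply_symm_apply]
    simp only [e₁, Polynomial.map_zero, pair_zero_right, add_zero]
    rw [sub_eq_add_neg, pair_add_left, pair_neg_left, pair_smul_left, pair_monomial, pair_monomial]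
    simp [Polynomial.coeff_one]
  have i₀ : ipS α x₁ (dρH₂ α x₀) = ((|α| * evenWeight α 0 : ℝ) : ℂ) := by
    have hw := (isSectorWeight_evenWeight α).succ 0
    rw [ipS_eq_weight, nfEquiv_dρH₂, h₀, h₁, LinearEquiv.apply_symm_apply,
      LinearEquiv.apply_symm_apply]
    simp only [sectorOp_monomial_zero, map_zero, Polynomial.map_zero, pair_zero_right, add_zero]
    rw [pair_monomial]
    simp [hw]
  rw [inner_toFock, inner_toFock, i₀, i₁, ← Complex.ofReal_add, Complex.ofReal_eq_zero,
    ← add_mul] at key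
  have h0 : α + |α| = 0 := (mul_eq_zero.1 key).resolve_right ((wt_sgn_pos α 0).ne')
  -- The relation `α + |α| = 0` only gives `α ≤ 0`; the excluded parameter `n = 0` makes it strict.
  have h1 : α ≠ 0 := by simpa using hα.out 0
  exact lt_of_le_of_ne (by linarith [abs_nonneg α]) h1

/-- The continuous extension of `symmInv` to the Fock space. -/
noncomputable def symmInvFock : Fock α →L[ℂ] Fock α :=
  (toFock α ∘ₗ symmInv α).extendOfNorm (toFock α)

theorem symmInvFock_toFock (x : PolyFock α) :
    symmInvFock α (toFock α x) = toFock α (symmInv α x) := by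
  refine LinearMap.extendOfNorm_eq (denseRange_toFock α) ⟨1, fun x => ?_⟩ x
  rw [one_mul]
  refine abs_le_of_sq_le_sq' ?_ (norm_nonneg _) |>.2
  rw [LinearMap.comp_apply, norm_sq_toFock, norm_sq_toFock, ipS_symmInv]

theorem symmInvFock_mem {f g : Fock α} (h : (f, g) ∈ fockGenerator α) :
    (symmInvFock α f, symmInvFock α g) ∈ fockGenerator α := by
  refine graphClosure_induction
    (Q := fun f g => (symmInvFock α f, symmInvFock α g) ∈ fockGenerator α)
    ((isClosed_graphClosure _ _).preimage (by fun_prop)) (fun x => ?_) h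
  rw [symmInvFock_toFock, symmInvFock_toFock, symmInv_dρH₂]
  exact mem_graphClosure _ _ _

/-- The right-hand side is jointly continuous and agrees with the product on pairs of polynomials,
so it is the unique continuous extension. -/
theorem bfFock_eq_inner (h : α < 0) (f g : Fock α) :
    bfFock α f g = inner ℂ (symmInvFock α g) f := by
  have := (Completion.isDenseInducing_coe (α := PolyFock α)).prodMap
    (Completion.isDenseInducing_coe (α := PolyFock α)) |>.extend_unique
    (f := fun x : PolyFock α × PolyFock α => bf α x.1 x.2)
    (g := fun x : Fock α × Fock α => inner ℂ (symmInvFock α x.2) x.1) (fun x => ?_) (by fun_prop)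
  · exact congrFun this (f, g)
  · rw [bf_eq_ipS_symmInv α h, ← inner_toFock, ← symmInvFock_toFock]
    rfl

theorem bfFock_map_map (h : α < 0) {U : ℝ → (Fock α →L[ℂ] Fock α)}
    (hU : IsGroupWithGenerator (fockGenerator α) U) (a : ℝ) (f g : Fock α) :
    bfFock α (U a f) (U a g) = bfFock α f g := by
  have hd := dense_domain (A := dρH₂ α) (denseRange_toFock α)
  have h0 := quasiSkew_zero_fockGenerator α h
  rw [bfFock_eq_inner α h, bfFock_eq_inner α h,
    hU.intertwine hU h0 hd (T := symmInvFock α) (fun _ _ => symmInvFock_mem α),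
    ContinuousLinearMap.inner_map_map_of_mem_unitary (hU.mem_unitary h0 hd a)]

end FockD21

/-- Unitarity of `exp(a dρ(H₂))`, `a ∈ ℝ`, on the Fock space. -/
theorem mainTheorem4 (α : ℝ) [Fact (∀ n : ℕ, α ≠ (n : ℝ))] :
    (∃! U : ℝ → (FockD21.Fock α →L[ℂ] FockD21.Fock α), FockD21.IsExpGroup α U) ∧
    ∀ U : ℝ → (FockD21.Fock α →L[ℂ] FockD21.Fock α), FockD21.IsExpGroup α U →
      ((∀ a : ℝ, U a ∈ unitary (FockD21.Fock α →L[ℂ] FockD21.Fock α)) ↔ α < 0) ∧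
      (α < 0 → ∀ (a : ℝ) (f g : FockD21.Fock α),
        FockD21.bfFock α (U a f) (U a g) = FockD21.bfFock α f g) := by
  refine ⟨FockD21.existsUnique_isExpGroup α, fun U hU => ?_⟩
  rw [FockD21.isExpGroup_iff] at hU
  exact ⟨⟨FockD21.neg_of_mem_unitary α hU, fun h => hU.mem_unitary
    (FockD21.quasiSkew_zero_fockGenerator α h) (dense_domain (FockD21.denseRange_toFock α))⟩,
    fun h => FockD21.bfFock_map_map α h hU⟩
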